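/- Let $U=SU(2)$, let $K=SO(2)\subset U$ be the subgroup of matrices with real entries, let $m_U$, $m_K$ be the Haar probability measures of $U$ and $K$, and let $N_U(K)$ be the normalizer of $K$ in $U$. For $a\in U$ let $\mu_a$ be the normalized $K$-bi-invariant measure on the double coset $KaK$, i.e. the probability measure with $\int_U f\,d\mu_a=\int_K\int_K f(k_1ak_2)\,dm_K(k_1)\,dm_K(k_2)$ for all $f\in C(U)$, and for an integer $p\ge 1$ let $\mu_a^{(p)}$ be the convolution of $p$ copies of $\mu_a$. (i) For every $a\in U\setminus N_U(K)$ and every integer $p\geq 3$, the measure $\mu_a^{(p)}$ is absolutely continuous with respect to $m_U$ and its density $d\mu_a^{(p)}/dm_U$ lies in $L^2(U,m_U)$. (ii) For every $\theta\in(\pi/12,\,5\pi/12)$, the element $a_\theta=\mathrm{diag}(e^{i\theta},e^{-i\theta})$ is not in $N_U(K)$, the measure $\mu_{a_\theta}^{(2)}$ is absolutely continuous with respect to $m_U$, and its density $d\mu_{a_\theta}^{(2)}/dm_U$ is not in $L^2(U,m_U)$. (iii) Consequently the $L^1$/$L^2$ dichotomy fails for the compact symmetric space $SU(2)/SO(2)$: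 it is not true that for all $a\in U\setminus N_U(K)$ and all integers $p\ge1$, $\mu_a^{(p)}$ is absolutely continuous with respect to $m_U$ if and only if it is absolutely continuous with a density in $L^2(U,m_U)$. -/

import Mathlib

open MeasureTheory

namespace OrbitalSU2

/-- The group `SU(2)` with the topology inherited from the space of complex matrices. -/
abbrev SU2 : Type := ↥(Matrix.specialUnitaryGroup (Fin 2) ℂ)

/-- The Borel sigma-algebra of `SU(2)`. -/
noncomputable instance instMeasurableSpaceSU2 : MeasurableSpace SU2 := borel SU2

instance instBorelSpaceSU2 : BorelSpace SU2 := ⟨rfl⟩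

instance instIsTopologicalGroupSU2 : IsTopologicalGroup SU2 where
  continuous_mul := by
    refine Continuous.subtype_mk ?_ _
    exact (continuous_subtype_val.comp continuous_fst).mul
      (continuous_subtype_val.comp continuous_snd)
  continuous_inv := by
    refine Continuous.subtype_mk ?_ _
    exact continuous_star.comp continuous_subtype_val

instance instSecondCountableTopologySU2 : SecondCountableTopology SU2 :=
  haveI : SecondCountableTopology (Matrix (Fin 2) (Fin 2) ℂ) :=
    inferInstanceAs (SecondCountableTopology (Fin 2 → Fin 2 → ℂ))
  TopologicalSpace.Subtype.secondCountableTopology _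

instance instCompactSpaceSU2 : CompactSpace SU2 := by
  refine isCompact_iff_compactSpace.1 (?_ :
    IsCompact (Matrix.specialUnitaryGroup (Fin 2) ℂ : Set (Matrix (Fin 2) (Fin 2) ℂ)))
  have hc : IsClosed ((Matrix.specialUnitaryGroup (Fin 2) ℂ : Set (Matrix (Fin 2) (Fin 2) ℂ))) := by
    have h : (Matrix.specialUnitaryGroup (Fin 2) ℂ : Set (Matrix (Fin 2) (Fin 2) ℂ)) =
        {A | A * star A = 1} ∩ {A | A.det = 1} := by
      ext A
      simp only [SetLike.mem_coe, Matrix.mem_specialUnitaryGroup_iff,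
        Matrix.mem_unitaryGroup_iff, Set.mem_inter_iff, Set.mem_ofPred_eq]
    rw [h]
    exact (isClosed_eq (by fun_prop) continuous_const).inter
      (isClosed_eq (by fun_prop) continuous_const)
  have hK : IsCompact (Set.univ.pi fun _ : Fin 2 => Set.univ.pi fun _ : Fin 2 =>
      Metric.closedBall (0 : ℂ) 1) :=
    isCompact_univ_pi fun _ => isCompact_univ_pi fun _ => isCompact_closedBall 0 1
  refine hK.of_isClosed_subset hc fun A hA i _ j _ => ?_
  rw [mem_closedBall_zero_iff]
  exact entry_norm_bound_of_unitary (Matrix.specialUnitaryGroup_le_unitaryGroup hA) i j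

/-- `SO(2)` as a subgroup of `SU(2)`: the elements whose matrix is the complexification of a real
special orthogonal matrix. -/
def SO2 : Subgroup SU2 where
  carrier := {u | ∃ k ∈ Matrix.specialOrthogonalGroup (Fin 2) ℝ,
    (u : Matrix (Fin 2) (Fin 2) ℂ) = k.map (fun x : ℝ => (x : ℂ))}
  mul_mem' := by
    rintro u v ⟨k, hk, hu⟩ ⟨l, hl, hv⟩
    refine ⟨k * l, mul_mem hk hl, ?_⟩
    rw [Submonoid.coe_mul, hu, hv]
    exact (Matrix.map_mul (f := Complex.ofRealHom)).symm
  one_mem' := ⟨1, one_mem _, by simp⟩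
  inv_mem' := by
    rintro u ⟨k, hk, hu⟩
    refine ⟨k.transpose, ?_, ?_⟩
    · rw [Matrix.mem_specialOrthogonalGroup_fin_two_iff] at hk ⊢
      simp only [Matrix.transpose_apply]
      exact ⟨hk.1, by linarith [hk.2.1], by rw [← neg_sq (k 1 0), ← hk.2.1]; exact hk.2.2⟩
    · change star (u : Matrix (Fin 2) (Fin 2) ℂ) = _
      rw [hu]
      ext i j
      simp [Matrix.star_apply]

theorem isClosed_SO2 : IsClosed (SO2 : Set SU2) := by
  have h : (SO2 : Set SU2) = {u | ∀ i j, (u.1 i j).im = 0} := by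
    ext u
    constructor
    · rintro ⟨k, -, hu⟩ i j
      simp [hu]
    · intro hu
      replace hu : ∀ i j, (u.1 i j).im = 0 := hu
      have hre : ∀ i j, u.1 i j = ((u.1 i j).re : ℂ) := fun i j =>
        Complex.ext (by simp) (by simpa using hu i j)
      have heq : (u : Matrix (Fin 2) (Fin 2) ℂ) =
          (u.1.map Complex.re).map (fun x : ℝ => (x : ℂ)) := by
        ext i j
        simpa using hre i j
      refine ⟨u.1.map Complex.re, ?_, heq⟩
      rw [Matrix.mem_specialOrthogonalGroup_iff, Matrix.mem_orthogonalGroup_iff]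
      obtain ⟨h1, h2⟩ := Matrix.mem_specialUnitaryGroup_iff.1 u.2
      rw [Matrix.mem_unitaryGroup_iff] at h1
      constructor
      · ext i j
        have := congrArg Complex.re (congrFun (congrFun h1 i) j)
        simp only [Matrix.mul_apply, Matrix.star_apply, Fin.sum_univ_two, Complex.add_re,
          Complex.mul_re, RCLike.star_def, Complex.conj_re, Complex.conj_im, hu] at this
        simp only [Matrix.mul_apply, Matrix.map_apply, Matrix.transpose_apply, Fin.sum_univ_two]
        rw [Matrix.one_apply] at this ⊢
        split_ifs at this ⊢ <;> simpa using this
      · have := congrArg Complex.re h2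
        rw [Matrix.det_fin_two] at this ⊢
        simpa [hu] using this
  rw [h]
  simp only [Set.ofPred_forall]
  refine isClosed_iInter fun i => isClosed_iInter fun j => isClosed_eq ?_ continuous_const
  exact Complex.continuous_im.comp (continuous_subtype_val.matrix_elem i j)

instance instCompactSpaceSO2 : CompactSpace SO2 :=
  isCompact_iff_compactSpace.1 isClosed_SO2.isCompact

/-- The Haar probability measure of `SU(2)`. -/
noncomputable def haarU : Measure SU2 := Measure.haarMeasure ⊤

/-- The Haar probability measure of `SO(2)`. -/
noncomputable def haarK : Measure SO2 := Measure.haarMeasure ⊤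

/-- The normalized `SO(2)`-bi-invariant measure on the double coset of `a`: the image of the product
of the Haar probability measures under `(k₁, k₂) ↦ k₁ a k₂`. -/
noncomputable def orbitalMeasure (a : SU2) : Measure SU2 :=
  (haarK.prod haarK).map fun k : SO2 × SO2 => (k.1 : SU2) * a * (k.2 : SU2)

/-- The `p`-fold convolution power of a measure, for the convolution `Measure.mconv`. -/
noncomputable def convPow {G : Type*} [Monoid G] [MeasurableSpace G] (μ : Measure G) :
    ℕ → Measure G
  | 0 => Measure.dirac 1
  | p + 1 => (convPow μ p).mconv μ

/-- The Radon-Nikodym derivative with respect to the Haar measure of `SU(2)`, as a real function. -/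
noncomputable def density (ν : Measure SU2) (x : SU2) : ℝ := (ν.rnDeriv haarU x).toReal

/-- The diagonal matrix with entries `exp (iθ)` and `exp (-iθ)`. -/
noncomputable def diagElement (θ : ℝ) : SU2 :=
  ⟨!![Complex.exp (θ * Complex.I), 0; 0, Complex.exp (-(θ * Complex.I))], by
    rw [Matrix.mem_specialUnitaryGroup_iff, Matrix.mem_unitaryGroup_iff]
    constructor
    · ext i j
      fin_cases i <;> fin_cases j <;>
        simp [Matrix.mul_apply, Fin.sum_univ_two, Matrix.star_apply, ← Complex.exp_conj,
          ← Complex.exp_add]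
    · simp [Matrix.det_fin_two, ← Complex.exp_add]⟩

end OrbitalSU2

namespace OrbitalSU2

/-! The quotient `SU(2)/SO(2)` is the two-sphere, and a double coset is a circle of latitude,
recorded by `height` in `[-1, 1]`. A bi-invariant measure is therefore a mixture of orbital measures
governed by the law of its height (`IsBiInvariant.lintegral_eq`). Under Haar measure this law is
uniform on `[-1, 1]` (`map_height_haarU`), so absolute continuity and square integrability become
questions about measures on an interval.

Convolving with the orbital measure of `a` acts on functions of the height by averaging over circles
of spherical radius `arccos (height a)`. This operator preserves the degree filtration of
polynomials and is symmetric for the uniform measure, hence diagonal on Legendre polynomials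
(`circleOp_monicLegendre`). The `n`-th Legendre coefficient of the `p`-fold convolution is thus the
`p`-th power of the `n`-th eigenvalue times the value at `1` of the orthonormal Legendre polynomial
(`integral_legendre_convPow`). If `a` is outside the normalizer, then `height a ^ 2 < 1`, and
Laplace's integral bounds the eigenvalue by a multiple of `n ^ (-1/2)` (`abs_circleEigenvalue_le`).
The squared value at `1` is at most `4 * n + 2`, so for `p ≥ 3` the squared coefficients are `O(n ^
(-2))`; Riesz–Fischer provides an `L²` density (`exists_density_of_summable`).

For `p = 2` the law of the height is the image of the uniform angle under an affine function of `cos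
(2 * t)`, with nonzero slope when `height a ^ 2 < 1`; it is absolutely continuous because preimages
of null sets under cosine are null. However, it gives mass at least `δ / π` to the neighbourhood
`height > 1 - 2 * δ ^ 2` of `SO(2)`, whose Haar measure is only `δ ^ 2`. By Cauchy–Schwarz an `L²`
density would have squared integral at least `1 / π ^ 2` on each of these shrinking sets, which is
impossible (`not_memLp_density_convPow_two`). -/

/-! ### Coordinates on `SU(2)`, the height and the Cartan decomposition -/

theorem star_eq_adjugate (u : SU2) : star u.1 = u.1.adjugate := by
  obtain ⟨h1, h2⟩ := Matrix.mem_specialUnitaryGroup_iff.1 u.2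
  rw [Matrix.mem_unitaryGroup_iff] at h1
  calc star u.1 = (u.1.adjugate * u.1) * star u.1 := by rw [Matrix.adjugate_mul, h2]; simp
    _ = u.1.adjugate := by rw [mul_assoc, h1, mul_one]

theorem apply_one_one (u : SU2) : u.1 1 1 = star (u.1 0 0) := by
  have h := congrFun (congrFun (star_eq_adjugate u) 0) 0
  simpa [Matrix.adjugate_fin_two, Matrix.star_apply] using h.symm

theorem apply_one_zero (u : SU2) : u.1 1 0 = -star (u.1 0 1) := by
  have h := congrFun (congrFun (star_eq_adjugate u) 1) 0
  rw [Matrix.star_apply, Matrix.adjugate_fin_two] at h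
  simp at h
  simp [h]

theorem SU2_ext {u v : SU2} (h0 : u.1 0 0 = v.1 0 0) (h1 : u.1 0 1 = v.1 0 1) : u = v := by
  refine Subtype.ext (Matrix.ext fun i j => ?_)
  fin_cases i <;> fin_cases j
  · exact h0
  · exact h1
  · change u.1 1 0 = v.1 1 0
    rw [apply_one_zero, apply_one_zero, h1]
  · change u.1 1 1 = v.1 1 1
    rw [apply_one_one, apply_one_one, h0]

theorem sum_sq_eq_one (u : SU2) :
    (u.1 0 0).re ^ 2 + (u.1 0 0).im ^ 2 + (u.1 0 1).re ^ 2 + (u.1 0 1).im ^ 2 = 1 := by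
  have h2 := (Matrix.mem_specialUnitaryGroup_iff.1 u.2).2
  rw [Matrix.det_fin_two, apply_one_one, apply_one_zero] at h2
  have := congrArg Complex.re h2
  simp at this
  linarith

/-- The polar coordinate on `SU(2)` that parametrizes the double cosets of `SO(2)`: half the real
part of the trace of `u * uᵀ`. -/
def height (u : SU2) : ℝ :=
  (u.1 0 0).re ^ 2 - (u.1 0 0).im ^ 2 + (u.1 0 1).re ^ 2 - (u.1 0 1).im ^ 2

theorem continuous_apply_SU2 (i j : Fin 2) : Continuous fun u : SU2 => u.1 i j :=
  continuous_subtype_val.matrix_elem i j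

theorem continuous_height : Continuous height := by
  have h0 := continuous_apply_SU2 0 0
  have h1 := continuous_apply_SU2 0 1
  unfold height
  have a := Complex.continuous_re.comp h0
  have b := Complex.continuous_im.comp h0
  have c := Complex.continuous_re.comp h1
  have d := Complex.continuous_im.comp h1
  exact (((a.pow 2).sub (b.pow 2)).add (c.pow 2)).sub (d.pow 2)

theorem height_mem_Icc (u : SU2) : height u ∈ Set.Icc (-1 : ℝ) 1 := by
  have := sum_sq_eq_one u
  unfold height
  constructor <;> nlinarith [sq_nonneg (u.1 0 0).re, sq_nonneg (u.1 0 0).im,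
    sq_nonneg (u.1 0 1).re, sq_nonneg (u.1 0 1).im]

theorem height_one : height 1 = 1 := by simp [height]

/-- The rotation with angle `t`, as an element of `SU(2)`. -/
noncomputable def rotU (t : ℝ) : SU2 :=
  ⟨!![(Real.cos t : ℂ), (Real.sin t : ℂ); -(Real.sin t : ℂ), (Real.cos t : ℂ)], by
    have h : (Real.cos t : ℂ) * Real.cos t + Real.sin t * Real.sin t = 1 := by
      have := Real.cos_sq_add_sin_sq t
      exact_mod_cast (by nlinarith : Real.cos t * Real.cos t + Real.sin t * Real.sin t = 1)
    rw [Matrix.mem_specialUnitaryGroup_iff, Matrix.mem_unitaryGroup_iff]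
    constructor
    · ext i j
      fin_cases i <;> fin_cases j <;>
        simp [Matrix.mul_apply, Fin.sum_univ_two, Matrix.star_apply,
          -Complex.ofReal_cos, -Complex.ofReal_sin, h, mul_comm]
      rw [add_comm]; exact h
    · simp only [Matrix.det_fin_two, Matrix.of_apply, Matrix.cons_val]
      rw [← h]; ring⟩

/-- The rotation with angle `t`, as an element of `SO(2)`. -/
noncomputable def rot (t : ℝ) : SO2 :=
  ⟨rotU t, !![Real.cos t, Real.sin t; -Real.sin t, Real.cos t], by
    rw [Matrix.mem_specialOrthogonalGroup_fin_two_iff]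
    simp, by
    ext i j
    fin_cases i <;> fin_cases j <;> simp [rotU]⟩

theorem rot_apply_zero_zero (t : ℝ) : (rot t : SU2).1 0 0 = ⟨Real.cos t, 0⟩ := rfl

theorem rot_apply_zero_one (t : ℝ) : (rot t : SU2).1 0 1 = ⟨Real.sin t, 0⟩ := rfl

theorem mul_apply_zero (u v : SU2) (j : Fin 2) :
    (u * v).1 0 j = u.1 0 0 * v.1 0 j + u.1 0 1 * v.1 1 j := by
  change (u.1 * v.1) 0 j = _
  rw [Matrix.mul_apply, Fin.sum_univ_two]

theorem rot_add (s t : ℝ) : rot (s + t) = rot s * rot t := by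
  refine Subtype.ext (SU2_ext ?_ ?_)
  · change _ = ((rot s : SU2) * (rot t : SU2)).1 0 0
    rw [mul_apply_zero, apply_one_zero]
    simp only [rot_apply_zero_zero, rot_apply_zero_one, Real.cos_add]
    apply Complex.ext <;> simp [sub_eq_add_neg]
  · change _ = ((rot s : SU2) * (rot t : SU2)).1 0 1
    rw [mul_apply_zero, apply_one_one]
    simp only [rot_apply_zero_zero, rot_apply_zero_one, Real.sin_add]
    apply Complex.ext <;> simp [add_comm]

theorem rot_two_pi : rot (2 * Real.pi) = 1 := by
  refine Subtype.ext (SU2_ext ?_ ?_)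
  · rw [rot_apply_zero_zero]; apply Complex.ext <;> simp
  · rw [rot_apply_zero_one]; apply Complex.ext <;> simp

theorem rot_periodic : Function.Periodic rot (2 * Real.pi) := fun t => by
  rw [rot_add, rot_two_pi, mul_one]

theorem continuous_rot : Continuous rot := by
  refine Continuous.subtype_mk (Continuous.subtype_mk ?_ _) _
  refine continuous_matrix fun i j => ?_
  fin_cases i <;> fin_cases j <;> simp <;> fun_prop

theorem exists_cos_sin {x y r : ℝ} (hr : 0 ≤ r) (h : x ^ 2 + y ^ 2 = r ^ 2) :
    ∃ t : ℝ, x = r * Real.cos t ∧ y = r * Real.sin t := by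
  refine ⟨Complex.arg ⟨x, y⟩, ?_⟩
  have hn : ‖(⟨x, y⟩ : ℂ)‖ = r := by
    rw [Complex.norm_eq_sqrt_sq_add_sq, h, Real.sqrt_sq hr]
  rw [← hn]
  exact ⟨(Complex.norm_mul_cos_arg ⟨x, y⟩).symm, (Complex.norm_mul_sin_arg ⟨x, y⟩).symm⟩

theorem rot_surjective : Function.Surjective rot := by
  rintro ⟨u, k, hk, hu⟩
  rw [Matrix.mem_specialOrthogonalGroup_fin_two_iff] at hk
  obtain ⟨t, h0, h1⟩ := exists_cos_sin (x := k 0 0) (y := k 0 1) zero_le_one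
    (by rw [hk.2.2, one_pow])
  refine ⟨t, Subtype.ext (SU2_ext ?_ ?_)⟩
  · rw [rot_apply_zero_zero]; apply Complex.ext <;> simp [hu, h0, -Complex.ofReal_cos]
  · rw [rot_apply_zero_one]; apply Complex.ext <;> simp [hu, h1, -Complex.ofReal_sin]

theorem height_rot_mul (t : ℝ) (u : SU2) : height ((rot t : SU2) * u) = height u := by
  unfold height
  rw [mul_apply_zero, mul_apply_zero, apply_one_one, apply_one_zero, rot_apply_zero_zero,
    rot_apply_zero_one]
  simp only [Complex.add_re, Complex.add_im, Complex.mul_re, Complex.mul_im,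
    Complex.neg_re, Complex.neg_im, RCLike.star_def, Complex.conj_re, Complex.conj_im]
  linear_combination ((u.1 0 0).re ^ 2 - (u.1 0 0).im ^ 2 + (u.1 0 1).re ^ 2
    - (u.1 0 1).im ^ 2) * Real.cos_sq_add_sin_sq t

theorem height_mul_rot (u : SU2) (t : ℝ) : height (u * (rot t : SU2)) = height u := by
  unfold height
  rw [mul_apply_zero, mul_apply_zero, apply_one_one, apply_one_zero, rot_apply_zero_zero,
    rot_apply_zero_one]
  simp only [Complex.add_re, Complex.add_im, Complex.mul_re, Complex.mul_im,
    Complex.neg_re, Complex.neg_im, RCLike.star_def, Complex.conj_re, Complex.conj_im]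
  linear_combination ((u.1 0 0).re ^ 2 - (u.1 0 0).im ^ 2 + (u.1 0 1).re ^ 2
    - (u.1 0 1).im ^ 2) * Real.cos_sq_add_sin_sq t

theorem height_mul_left (k : SO2) (u : SU2) : height ((k : SU2) * u) = height u := by
  obtain ⟨t, rfl⟩ := rot_surjective k
  exact height_rot_mul t u

theorem height_mul_right (u : SU2) (k : SO2) : height (u * (k : SU2)) = height u := by
  obtain ⟨t, rfl⟩ := rot_surjective k
  exact height_mul_rot u t

theorem diagElement_apply_zero_zero (θ : ℝ) :
    (diagElement θ).1 0 0 = ⟨Real.cos θ, Real.sin θ⟩ := by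
  change Complex.exp (θ * Complex.I) = _
  rw [Complex.exp_mul_I]
  apply Complex.ext <;> simp [Complex.cos_ofReal_re, Complex.sin_ofReal_re]

theorem diagElement_apply_zero_one (θ : ℝ) : (diagElement θ).1 0 1 = 0 := rfl

/-- This is the spherical law of cosines; all angles are doubled because the group acts on the
sphere through its double cover of the rotation group. -/
theorem height_diagElement_mul (θ t φ : ℝ) :
    height (diagElement θ * (rot t : SU2) * diagElement φ) =
      Real.cos (2 * θ) * Real.cos (2 * φ)
        - Real.sin (2 * θ) * Real.sin (2 * φ) * Real.cos (2 * t) := by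
  have h0 : (diagElement θ * (rot t : SU2) * diagElement φ).1 0 0 =
      ⟨Real.cos (θ + φ) * Real.cos t, Real.sin (θ + φ) * Real.cos t⟩ := by
    rw [mul_apply_zero, mul_apply_zero, mul_apply_zero, apply_one_zero, apply_one_zero,
      apply_one_one]
    simp only [diagElement_apply_zero_zero, diagElement_apply_zero_one, rot_apply_zero_zero,
      rot_apply_zero_one, Real.cos_add, Real.sin_add]
    apply Complex.ext <;> simp <;> ring
  have h1 : (diagElement θ * (rot t : SU2) * diagElement φ).1 0 1 =
      ⟨Real.cos (θ - φ) * Real.sin t, Real.sin (θ - φ) * Real.sin t⟩ := by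
    rw [mul_apply_zero, mul_apply_zero, mul_apply_zero, apply_one_one, apply_one_zero,
      apply_one_one]
    simp only [diagElement_apply_zero_zero, diagElement_apply_zero_one, rot_apply_zero_zero,
      rot_apply_zero_one, Real.cos_sub, Real.sin_sub]
    apply Complex.ext <;> simp <;> ring
  unfold height
  rw [h0, h1]
  simp only
  have e1 : Real.cos (2 * θ) * Real.cos (2 * φ) - Real.sin (2 * θ) * Real.sin (2 * φ) =
      Real.cos (θ + φ) ^ 2 - Real.sin (θ + φ) ^ 2 := by
    rw [← Real.cos_add, ← Real.cos_two_mul', mul_add]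
  have e2 : Real.cos (2 * θ) * Real.cos (2 * φ) + Real.sin (2 * θ) * Real.sin (2 * φ) =
      Real.cos (θ - φ) ^ 2 - Real.sin (θ - φ) ^ 2 := by
    rw [← Real.cos_sub, ← Real.cos_two_mul', mul_sub]
  rw [Real.cos_two_mul' t]
  linear_combination (-Real.cos t ^ 2) * e1 - Real.sin t ^ 2 * e2
    + Real.cos (2 * θ) * Real.cos (2 * φ) * Real.cos_sq_add_sin_sq t

theorem height_diagElement (θ : ℝ) : height (diagElement θ) = Real.cos (2 * θ) := by
  unfold height
  rw [diagElement_apply_zero_zero, diagElement_apply_zero_one, Real.cos_two_mul']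
  simp

/-- A continuous section of `height`. -/
noncomputable def polarSection (t : ℝ) : SU2 := diagElement (Real.arccos t / 2)

theorem height_polarSection {t : ℝ} (ht : t ∈ Set.Icc (-1 : ℝ) 1) : height (polarSection t) = t := by
  rw [polarSection, height_diagElement, mul_div_cancel₀ _ two_ne_zero, Real.cos_arccos ht.1 ht.2]

/-- The real and imaginary parts of the first row are plane vectors of lengths `cos θ` and `sin θ`,
so `u` is determined by `θ` and their polar angles `p` and `q`. -/
theorem exists_eq_mul_polarSection_mul (u : SU2) :
    ∃ k l : SO2, u = (k : SU2) * polarSection (height u) * (l : SU2) := by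
  set θ := Real.arccos (height u) / 2 with hθ
  have hcos : Real.cos (2 * θ) = height u := by
    rw [← height_diagElement]; exact height_polarSection (height_mem_Icc u)
  have hs := sum_sq_eq_one u
  have h0 : 0 ≤ θ := by have := Real.arccos_nonneg (height u); positivity
  have h1 : θ ≤ Real.pi / 2 := by
    have := Real.arccos_le_pi (height u); rw [hθ]; linarith
  obtain ⟨p, hp0, hp1⟩ := exists_cos_sin (x := (u.1 0 0).re) (y := (u.1 0 1).re)
    (Real.cos_nonneg_of_neg_pi_div_two_le_of_le (by linarith [Real.pi_pos]) h1)
    (by rw [Real.cos_two_mul] at hcos; unfold height at hcos; linarith)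
  obtain ⟨q, hq0, hq1⟩ := exists_cos_sin (x := (u.1 0 0).im) (y := (u.1 0 1).im)
    (Real.sin_nonneg_of_nonneg_of_le_pi h0 (by linarith [Real.pi_pos]))
    (by rw [Real.sin_sq]; rw [Real.cos_two_mul] at hcos; unfold height at hcos; linarith)
  -- In `rot a * diagElement θ * rot b` the polar angles of the real and imaginary rows are `a + b`
  -- and `b - a`; solve for `a` and `b`.
  refine ⟨rot ((p - q) / 2), rot ((p + q) / 2), ?_⟩
  have hp : p = (p - q) / 2 + (p + q) / 2 := by ring
  have hq : q = (p + q) / 2 - (p - q) / 2 := by ring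
  set a := (p - q) / 2
  set b := (p + q) / 2
  rw [hp] at hp0 hp1
  rw [hq] at hq0 hq1
  rw [Real.cos_add] at hp0
  rw [Real.sin_add] at hp1
  rw [Real.cos_sub] at hq0
  rw [Real.sin_sub] at hq1
  change u = (rot a : SU2) * diagElement θ * (rot b : SU2)
  apply SU2_ext
  · rw [mul_apply_zero, mul_apply_zero, mul_apply_zero, apply_one_zero, apply_one_zero,
      apply_one_one]
    simp only [diagElement_apply_zero_zero, diagElement_apply_zero_one, rot_apply_zero_zero,
      rot_apply_zero_one]
    apply Complex.ext
    · rw [hp0]; simp; ring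
    · rw [hq0]; simp; ring
  · rw [mul_apply_zero, mul_apply_zero, mul_apply_zero, apply_one_zero, apply_one_one,
      apply_one_one]
    simp only [diagElement_apply_zero_zero, diagElement_apply_zero_one, rot_apply_zero_zero,
      rot_apply_zero_one]
    apply Complex.ext
    · rw [hp1]; simp; ring
    · rw [hq1]; simp; ring

theorem continuous_polarSection : Continuous polarSection := by
  unfold polarSection
  refine Continuous.subtype_mk (continuous_matrix fun i j => ?_) _
  have := Real.continuous_arccos
  fin_cases i <;> fin_cases j <;> simp <;> fun_prop

/-! ### The normalizer of `SO(2)` -/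

/-- The poles of the sphere: at height `1` the polar part is the identity, and at height `-1` it is
`diag(i, -i)`, which conjugates each rotation to its inverse. -/
theorem mem_normalizer_SO2_of_sq_height {a : SU2} (h : height a ^ 2 = 1) :
    a ∈ Subgroup.normalizer (SO2 : Set SU2) := by
  have key : polarSection (height a) ∈ Subgroup.normalizer (SO2 : Set SU2) := by
    rcases sq_eq_one_iff.1 h with h | h
    · have : polarSection (height a) = 1 := by
        rw [h, polarSection, Real.arccos_one, zero_div]
        apply SU2_ext
        · rw [diagElement_apply_zero_zero]; apply Complex.ext <;> simp
        · rw [diagElement_apply_zero_one]; simp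
      rw [this]
      exact one_mem _
    · rw [h, polarSection, Real.arccos_neg_one]
      have hc : ∀ t, diagElement (Real.pi / 2) * (rot t : SU2) * (diagElement (Real.pi / 2))⁻¹ =
          (rot (-t) : SU2) := fun t => by
        rw [mul_inv_eq_iff_eq_mul]
        apply SU2_ext <;> rw [mul_apply_zero, mul_apply_zero] <;>
          simp only [apply_one_one, apply_one_zero, diagElement_apply_zero_zero,
            diagElement_apply_zero_one, rot_apply_zero_zero, rot_apply_zero_one] <;>
          apply Complex.ext <;> simp
      rw [Subgroup.mem_normalizer_iff]
      intro g
      constructor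
      · intro hg
        obtain ⟨t, ht⟩ := rot_surjective ⟨g, hg⟩
        have := hc t
        rw [ht] at this
        rw [this]
        exact (rot (-t)).2
      · intro hg
        obtain ⟨t, ht⟩ := rot_surjective ⟨_, hg⟩
        have := hc (-t)
        rw [neg_neg, ht] at this
        have hg' : g = (rot (-t) : SU2) := mul_left_cancel (mul_right_cancel this).symm
        rw [hg']
        exact (rot (-t)).2
  obtain ⟨k, l, hkl⟩ := exists_eq_mul_polarSection_mul a
  rw [hkl]
  exact mul_mem (mul_mem (Subgroup.le_normalizer k.2) key) (Subgroup.le_normalizer l.2)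

theorem diagElement_notMem_normalizer {θ : ℝ} (h : Real.sin (2 * θ) ≠ 0) :
    diagElement θ ∉ Subgroup.normalizer (SO2 : Set SU2) := by
  intro hn
  rw [Subgroup.mem_normalizer_iff] at hn
  have := (hn (rot (Real.pi / 2))).1 (rot _).2
  obtain ⟨k, -, hk⟩ := this
  -- Conjugating the quarter turn produces the entry `exp (2iθ)`, which would have to be real.
  have h1 : (diagElement θ * (rot (Real.pi / 2) : SU2) * (diagElement θ)⁻¹).1 0 1 =
      ⟨Real.cos (2 * θ), Real.sin (2 * θ)⟩ := by
    have hstar : ((diagElement θ)⁻¹).1 = star (diagElement θ).1 := rfl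
    rw [mul_apply_zero, mul_apply_zero, mul_apply_zero, hstar]
    simp only [Matrix.star_apply, apply_one_one, apply_one_zero, diagElement_apply_zero_zero,
      diagElement_apply_zero_one, rot_apply_zero_zero, rot_apply_zero_one]
    apply Complex.ext <;> simp [Real.cos_two_mul', Real.sin_two_mul] <;> ring
  rw [hk] at h1
  have := congrArg Complex.im h1
  simp at this
  exact h this.symm

/-! ### Haar measures and the angle on `SO(2)` -/

theorem isMulRightInvariant_haarMeasure_top {G : Type*} [Group G] [TopologicalSpace G]
    [IsTopologicalGroup G] [CompactSpace G] [SecondCountableTopology G] [MeasurableSpace G]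
    [BorelSpace G] :
    (Measure.haarMeasure (⊤ : TopologicalSpace.PositiveCompacts G)).IsMulRightInvariant := by
  have hp : IsProbabilityMeasure (Measure.haarMeasure (⊤ : TopologicalSpace.PositiveCompacts G)) :=
    ⟨by simpa using Measure.haarMeasure_self (K₀ := (⊤ : TopologicalSpace.PositiveCompacts G))⟩
  refine ⟨fun g => ?_⟩
  have : IsProbabilityMeasure
      ((Measure.haarMeasure (⊤ : TopologicalSpace.PositiveCompacts G)).map (· * g)) :=
    Measure.isProbabilityMeasure_map (measurable_mul_const g).aemeasurable
  exact Measure.isHaarMeasure_eq_of_isProbabilityMeasure _ _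

instance : SecondCountableTopology SO2 := TopologicalSpace.Subtype.secondCountableTopology _

instance : haarU.IsHaarMeasure := by unfold haarU; infer_instance

instance : haarK.IsHaarMeasure := by unfold haarK; infer_instance

instance : haarU.IsMulRightInvariant := isMulRightInvariant_haarMeasure_top

instance : haarK.IsMulRightInvariant := isMulRightInvariant_haarMeasure_top

instance : IsProbabilityMeasure haarU :=
  ⟨by simpa [haarU] using
    Measure.haarMeasure_self (K₀ := (⊤ : TopologicalSpace.PositiveCompacts SU2))⟩

instance : IsProbabilityMeasure haarK :=
  ⟨by simpa [haarK] using
    Measure.haarMeasure_self (K₀ := (⊤ : TopologicalSpace.PositiveCompacts SO2))⟩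

theorem measurable_height : Measurable height := continuous_height.measurable

theorem measurable_rot : Measurable rot := continuous_rot.measurable

/-- The uniform probability measure on `(0, 2π]`. -/
noncomputable def angleMeasure : Measure ℝ :=
  ENNReal.ofReal (2 * Real.pi)⁻¹ • volume.restrict (Set.Ioc 0 (2 * Real.pi))

instance : IsProbabilityMeasure angleMeasure := ⟨by
  have := Real.pi_pos
  rw [angleMeasure, Measure.smul_apply, Measure.restrict_apply_univ, Real.volume_Ioc, smul_eq_mul,
    ← ENNReal.ofReal_mul (by positivity), sub_zero, inv_mul_cancel₀ (by positivity),
    ENNReal.ofReal_one]⟩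

theorem integral_angleMeasure {E : Type*} [NormedAddCommGroup E] [NormedSpace ℝ E] (f : ℝ → E) :
    ∫ t, f t ∂angleMeasure = (2 * Real.pi)⁻¹ • ∫ t in (0 : ℝ)..2 * Real.pi, f t := by
  have := Real.pi_pos
  rw [angleMeasure, integral_smul_measure, intervalIntegral.integral_of_le (by positivity),
    ENNReal.toReal_ofReal (by positivity)]

theorem integral_angleMeasure_add {E : Type*} [NormedAddCommGroup E] [NormedSpace ℝ E] {f : ℝ → E}
    (hf : Function.Periodic f (2 * Real.pi)) (s : ℝ) :
    ∫ t, f (t + s) ∂angleMeasure = ∫ t, f t ∂angleMeasure := by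
  rw [integral_angleMeasure, integral_angleMeasure, intervalIntegral.integral_comp_add_right,
    zero_add, add_comm, hf.intervalIntegral_add_eq s 0, zero_add]

/-- Average `f (rot t * k)` over both variables: periodicity removes `k` from the integral over `t`,
invariance of Haar measure removes `t` from the integral over `k`. -/
theorem map_rot_angleMeasure : angleMeasure.map rot = haarK := by
  let _ : MetricSpace SO2 := TopologicalSpace.metrizableSpaceMetric SO2
  have : IsProbabilityMeasure (angleMeasure.map rot) :=
    Measure.isProbabilityMeasure_map measurable_rot.aemeasurable
  refine ext_of_forall_integral_eq_of_IsFiniteMeasure fun f => ?_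
  rw [integral_map measurable_rot.aemeasurable f.continuous.aestronglyMeasurable]
  have hc : Continuous fun q : ℝ × SO2 => rot q.1 * q.2 :=
    (continuous_rot.comp continuous_fst).mul continuous_snd
  have hint : Integrable (fun q : ℝ × SO2 => f (rot q.1 * q.2)) (angleMeasure.prod haarK) :=
    (f.compContinuous ⟨_, hc⟩).integrable _
  calc ∫ t, f (rot t) ∂angleMeasure
      = ∫ k, ∫ t, f (rot t * k) ∂angleMeasure ∂haarK := by
        have h : ∀ k, ∫ t, f (rot t * k) ∂angleMeasure = ∫ t, f (rot t) ∂angleMeasure := fun k => by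
          obtain ⟨s, rfl⟩ := rot_surjective k
          simp_rw [← rot_add]
          exact integral_angleMeasure_add (f := fun t => f (rot t)) (rot_periodic.comp f) s
        simp [h]
    _ = ∫ t, ∫ k, f (rot t * k) ∂haarK ∂angleMeasure := (integral_integral_swap hint).symm
    _ = ∫ k, f k ∂haarK := by
        simp [integral_mul_left_eq_self (μ := haarK) (fun k => f k)]

/-! ### Bi-invariant measures and their disintegration over the height -/

theorem measurable_coe_SO2 : Measurable (fun k : SO2 => (k : SU2)) := measurable_subtype_coe

theorem measurable_mul_mul : Measurable fun q : SU2 × SO2 × SO2 =>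
    (q.2.1 : SU2) * q.1 * (q.2.2 : SU2) :=
  ((measurable_coe_SO2.comp (measurable_fst.comp measurable_snd)).mul measurable_fst).mul
    (measurable_coe_SO2.comp (measurable_snd.comp measurable_snd))

theorem measurable_orbit_map (a : SU2) : Measurable fun k : SO2 × SO2 =>
    (k.1 : SU2) * a * (k.2 : SU2) :=
  ((measurable_coe_SO2.comp measurable_fst).mul_const a).mul (measurable_coe_SO2.comp measurable_snd)

instance (a : SU2) : IsProbabilityMeasure (orbitalMeasure a) :=
  Measure.isProbabilityMeasure_map (measurable_orbit_map a).aemeasurable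

instance (μ : Measure SU2) [IsProbabilityMeasure μ] (p : ℕ) :
    IsProbabilityMeasure (convPow μ p) := by
  induction p with
  | zero => unfold convPow; infer_instance
  | succ p ih => unfold convPow; infer_instance

theorem map_mul_mul_orbitalMeasure (a : SU2) (k l : SO2) :
    (orbitalMeasure a).map (fun u => (k : SU2) * u * (l : SU2)) = orbitalMeasure a := by
  have h : MeasurePreserving (Prod.map (fun x => k * x) (fun x => x * l))
      (haarK.prod haarK) (haarK.prod haarK) :=
    (measurePreserving_mul_left haarK k).prod (measurePreserving_mul_right haarK l)
  conv_rhs => rw [orbitalMeasure, ← h.map_eq]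
  rw [orbitalMeasure, Measure.map_map (by fun_prop) (measurable_orbit_map a),
    Measure.map_map (measurable_orbit_map a) h.measurable]
  congr 1
  ext1 q
  simp [mul_assoc]

theorem orbitalMeasure_mul_mul (a : SU2) (k l : SO2) :
    orbitalMeasure ((k : SU2) * a * (l : SU2)) = orbitalMeasure a := by
  have h : MeasurePreserving (Prod.map (fun x => x * k) (fun x => l * x))
      (haarK.prod haarK) (haarK.prod haarK) :=
    (measurePreserving_mul_right haarK k).prod (measurePreserving_mul_left haarK l)
  conv_rhs => rw [orbitalMeasure, ← h.map_eq]
  rw [orbitalMeasure, Measure.map_map (measurable_orbit_map a) h.measurable]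
  congr 1
  ext1 q
  simp [mul_assoc]

theorem orbitalMeasure_polarSection (a : SU2) :
    orbitalMeasure (polarSection (height a)) = orbitalMeasure a := by
  obtain ⟨k, l, h⟩ := exists_eq_mul_polarSection_mul a
  conv_rhs => rw [h, orbitalMeasure_mul_mul]

/-- Invariance under left and right translations by `SO(2)`. -/
def IsBiInvariant (ν : Measure SU2) : Prop :=
  ∀ k l : SO2, ν.map (fun u => (k : SU2) * u * (l : SU2)) = ν

theorem isBiInvariant_haarU : IsBiInvariant haarU := fun k l =>
  ((measurePreserving_mul_right haarU (l : SU2)).comp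
    (measurePreserving_mul_left haarU (k : SU2))).map_eq

theorem IsBiInvariant.mconv {ν ρ : Measure SU2} [SFinite ν] [SFinite ρ] (hν : IsBiInvariant ν)
    (hρ : IsBiInvariant ρ) : IsBiInvariant (ν.mconv ρ) := by
  intro k l
  have h1 : MeasurePreserving (fun u : SU2 => (k : SU2) * u) ν ν :=
    ⟨by fun_prop, by simpa using hν k 1⟩
  have h2 : MeasurePreserving (fun u : SU2 => u * (l : SU2)) ρ ρ :=
    ⟨by fun_prop, by simpa using hρ 1 l⟩
  have h := (h1.prod h2).map_eq
  unfold Measure.mconv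
  conv_rhs => rw [← h]
  rw [Measure.map_map (by fun_prop) (by fun_prop), Measure.map_map (by fun_prop) (by fun_prop)]
  congr 1
  ext1 q
  simp [mul_assoc]

/-- The zeroth power is the Dirac mass at `1`, which is not bi-invariant, so the induction starts at
one factor. -/
theorem isBiInvariant_convPow (a : SU2) {p : ℕ} (hp : 1 ≤ p) :
    IsBiInvariant (convPow (orbitalMeasure a) p) := by
  induction p, hp using Nat.le_induction with
  | base =>
    simp only [convPow, Measure.dirac_one_mconv]
    exact map_mul_mul_orbitalMeasure a
  | succ p _ ih => exact ih.mconv (map_mul_mul_orbitalMeasure a)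

theorem measurable_lintegral_orbitalMeasure {F : SU2 → ENNReal} (hF : Measurable F) :
    Measurable fun a => ∫⁻ x, F x ∂orbitalMeasure a := by
  have : ∀ a, ∫⁻ x, F x ∂orbitalMeasure a =
      ∫⁻ k, F ((k.1 : SU2) * a * (k.2 : SU2)) ∂(haarK.prod haarK) := fun a =>
    lintegral_map hF (measurable_orbit_map a)
  simp_rw [this]
  exact (hF.comp measurable_mul_mul).lintegral_prod_right'

/-- The orbital measure of `a` depends only on `height a`. Averaging `F` over both copies of `SO(2)`
leaves its `ν`-integral unchanged and turns it into a function of the height. -/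
theorem IsBiInvariant.lintegral_eq {ν : Measure SU2} [SFinite ν] (hν : IsBiInvariant ν)
    {F : SU2 → ENNReal} (hF : Measurable F) :
    ∫⁻ x, F x ∂ν = ∫⁻ t, ∫⁻ x, F x ∂orbitalMeasure (polarSection t) ∂(ν.map height) := by
  have hm : Measurable fun t => ∫⁻ x, F x ∂orbitalMeasure (polarSection t) :=
    (measurable_lintegral_orbitalMeasure hF).comp continuous_polarSection.measurable
  rw [lintegral_map hm measurable_height]
  simp_rw [orbitalMeasure_polarSection]
  have : ∀ a, ∫⁻ x, F x ∂orbitalMeasure a =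
      ∫⁻ k, F ((k.1 : SU2) * a * (k.2 : SU2)) ∂(haarK.prod haarK) := fun a =>
    lintegral_map hF (measurable_orbit_map a)
  simp_rw [this]
  rw [lintegral_lintegral_swap (f := fun a (k : SO2 × SO2) => F ((k.1 : SU2) * a * (k.2 : SU2)))
    (hF.comp measurable_mul_mul).aemeasurable]
  have h : ∀ k : SO2 × SO2, ∫⁻ a, F ((k.1 : SU2) * a * (k.2 : SU2)) ∂ν = ∫⁻ x, F x ∂ν :=
    fun k => by
      rw [← lintegral_map hF (by fun_prop), hν k.1 k.2]
  simp [h]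

/-! ### Spherical means and convolution with an orbital measure -/

/-- The law of the height of a uniformly distributed point on the circle of the unit sphere that
consists of the points at spherical distance `arccos c` from a point of height `z`. -/
noncomputable def circleLaw (c z : ℝ) : Measure ℝ :=
  angleMeasure.map fun t => c * z - √(1 - c ^ 2) * √(1 - z ^ 2) * Real.cos (2 * t)

theorem measurable_circleLaw_map (c z : ℝ) :
    Measurable fun t => c * z - √(1 - c ^ 2) * √(1 - z ^ 2) * Real.cos (2 * t) := by fun_prop

instance (c z : ℝ) : IsProbabilityMeasure (circleLaw c z) :=
  Measure.isProbabilityMeasure_map (measurable_circleLaw_map c z).aemeasurable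

theorem measurable_height_mul_mul (x a : SU2) : Measurable fun k : SO2 => height (x * k * a) :=
  measurable_height.comp (by fun_prop)

theorem map_height_mul_mul (x a : SU2) :
    haarK.map (fun k : SO2 => height (x * k * a)) = circleLaw (height a) (height x) := by
  obtain ⟨k₁, l₁, hx⟩ := exists_eq_mul_polarSection_mul x
  obtain ⟨k₂, l₂, ha⟩ := exists_eq_mul_polarSection_mul a
  -- The inner rotations of the two Cartan decompositions are absorbed into `k`, the outer ones do
  -- not affect the height.
  have h1 : MeasurePreserving (fun k => l₁ * k * k₂) haarK haarK :=
    (measurePreserving_mul_right haarK k₂).comp (measurePreserving_mul_left haarK l₁)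
  have h2 : (fun k : SO2 => height (x * k * a)) =
      (fun k : SO2 => height (polarSection (height x) * k * polarSection (height a))) ∘
        fun k => l₁ * k * k₂ := by
    ext k
    conv_lhs => rw [hx, ha]
    have : (k₁ : SU2) * polarSection (height x) * l₁ * k * (k₂ * polarSection (height a) * l₂) =
        k₁ * (polarSection (height x) * (l₁ * k * k₂ : SO2) * polarSection (height a)) * l₂ := by
      simp [mul_assoc]
    rw [this, height_mul_right, height_mul_left]
    rfl
  rw [h2, ← Measure.map_map (measurable_height_mul_mul _ _) h1.measurable, h1.map_eq,
    ← map_rot_angleMeasure, Measure.map_map (measurable_height_mul_mul _ _) measurable_rot]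
  unfold circleLaw
  congr 1
  ext t
  simp only [Function.comp, polarSection]
  rw [height_diagElement_mul, mul_div_cancel₀ _ two_ne_zero, mul_div_cancel₀ _ two_ne_zero,
    Real.sin_arccos, Real.sin_arccos, Real.cos_arccos (height_mem_Icc x).1 (height_mem_Icc x).2,
    Real.cos_arccos (height_mem_Icc a).1 (height_mem_Icc a).2]
  ring

theorem integral_circleLaw {f : ℝ → ℝ} (hf : Continuous f) (x a : SU2) :
    ∫ y, f y ∂circleLaw (height a) (height x) = ∫ k : SO2, f (height (x * k * a)) ∂haarK := by
  rw [← map_height_mul_mul, integral_map (measurable_height_mul_mul x a).aemeasurable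
    hf.aestronglyMeasurable]

theorem integrable_of_continuous {f : SU2 → ℝ} (hf : Continuous f) (ν : Measure SU2)
    [IsFiniteMeasure ν] : Integrable f ν :=
  (BoundedContinuousFunction.mkOfCompact ⟨f, hf⟩).integrable ν

theorem integral_height_mconv (ν : Measure SU2) [IsProbabilityMeasure ν] (a : SU2) {f : ℝ → ℝ}
    (hf : Continuous f) :
    ∫ x, f (height x) ∂(ν.mconv (orbitalMeasure a)) =
      ∫ x, ∫ y, f y ∂circleLaw (height a) (height x) ∂ν := by
  have hfh : Continuous fun x => f (height x) := hf.comp continuous_height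
  rw [integral_mconv (integrable_of_continuous hfh _)]
  congr 1
  ext x
  have hx : Continuous fun y => f (height (x * y)) := hfh.comp (continuous_const_mul x)
  rw [orbitalMeasure, integral_map (measurable_orbit_map a).aemeasurable hx.aestronglyMeasurable,
    integral_circleLaw hf]
  have : ∀ k : SO2 × SO2, f (height (x * ((k.1 : SU2) * a * (k.2 : SU2)))) =
      f (height (x * k.1 * a)) := fun k => by
    rw [← mul_assoc, ← mul_assoc, height_mul_right]
  simp_rw [this]
  rw [integral_fun_fst (μ := haarK) (ν := haarK) (fun k : SO2 => f (height (x * k * a)))]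
  simp

theorem lintegral_height_mconv (ν : Measure SU2) [IsProbabilityMeasure ν] (a : SU2)
    {f : ℝ → ENNReal} (hf : Measurable f) :
    ∫⁻ x, f (height x) ∂(ν.mconv (orbitalMeasure a)) =
      ∫⁻ x, ∫⁻ y, f y ∂circleLaw (height a) (height x) ∂ν := by
  have hfh : Measurable fun x => f (height x) := hf.comp measurable_height
  rw [Measure.lintegral_mconv hfh]
  congr 1
  ext x
  have hx : Measurable fun y => f (height (x * y)) := hfh.comp (measurable_const_mul x)
  rw [orbitalMeasure, lintegral_map hx (measurable_orbit_map a), ← map_height_mul_mul, lintegral_map hf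
    (measurable_height_mul_mul x a)]
  have : ∀ k : SO2 × SO2, f (height (x * ((k.1 : SU2) * a * (k.2 : SU2)))) =
      f (height (x * k.1 * a)) := fun k => by
    rw [← mul_assoc, ← mul_assoc, height_mul_right]
  simp_rw [this]
  rw [lintegral_prod (fun k : SO2 × SO2 => f (height (x * k.1 * a)))
    ((hf.comp (measurable_height_mul_mul x a)).comp measurable_fst).aemeasurable]
  simp

theorem ae_height_eq_orbitalMeasure (a : SU2) : ∀ᵐ x ∂orbitalMeasure a, height x = height a := by
  rw [orbitalMeasure, ae_map_iff (measurable_orbit_map a).aemeasurable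
    (measurableSet_eq_fun measurable_height measurable_const)]
  simp only [height_mul_right, height_mul_left, Filter.eventually_true]

theorem map_height_convPow_two (a : SU2) :
    (convPow (orbitalMeasure a) 2).map height = circleLaw (height a) (height a) := by
  ext s hs
  have hg : Measurable (s.indicator (1 : ℝ → ENNReal)) := measurable_one.indicator hs
  have hae := ae_height_eq_orbitalMeasure a
  rw [← lintegral_indicator_one hs, ← lintegral_indicator_one hs,
    lintegral_map hg measurable_height]
  simp only [convPow, Measure.dirac_one_mconv]
  rw [lintegral_height_mconv _ a hg]
  have : ∀ᵐ x ∂orbitalMeasure a, ∫⁻ y, s.indicator 1 y ∂circleLaw (height a) (height x) =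
      ∫⁻ y, s.indicator 1 y ∂circleLaw (height a) (height a) := by
    filter_upwards [hae] with x hx
    rw [hx]
  rw [lintegral_congr_ae this]
  simp

theorem height_inv (a : SU2) : height a⁻¹ = height a := by
  have hstar : (a⁻¹).1 = star a.1 := rfl
  unfold height
  rw [hstar]
  simp only [Matrix.star_apply, apply_one_zero]
  simp

/-- Averaging with `circleLaw c` is symmetric with respect to the law of `height`. -/
theorem integral_circleLaw_mul_comm {c : ℝ} (hc : c ∈ Set.Icc (-1 : ℝ) 1) {f g : ℝ → ℝ}
    (hf : Continuous f) (hg : Continuous g) :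
    ∫ u, (∫ y, f y ∂circleLaw c (height u)) * g (height u) ∂haarU =
      ∫ u, f (height u) * ∫ y, g y ∂circleLaw c (height u) ∂haarU := by
  set a := polarSection c with ha
  have hca : height a = c := height_polarSection hc
  have hcont : Continuous fun q : SU2 × SO2 => q.1 * q.2 * a := by fun_prop
  have hcont' : Continuous fun q : SU2 × SO2 => q.1 * q.2 * a⁻¹ := by fun_prop
  have hfh := hf.comp continuous_height
  have hgh := hg.comp continuous_height
  have hint {F : SU2 × SO2 → ℝ} (hF : Continuous F) : Integrable F (haarU.prod haarK) :=
    (BoundedContinuousFunction.mkOfCompact ⟨F, hF⟩).integrable _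
  calc ∫ u, (∫ y, f y ∂circleLaw c (height u)) * g (height u) ∂haarU
      = ∫ u, ∫ k : SO2, f (height (u * k * a)) * g (height u) ∂haarK ∂haarU := by
        simp_rw [← hca, integral_circleLaw hf, integral_mul_const]
    _ = ∫ k : SO2, ∫ u, f (height (u * k * a)) * g (height u) ∂haarU ∂haarK :=
        integral_integral_swap (hint ((hfh.comp hcont).mul (hgh.comp continuous_fst)))
    _ = ∫ u, f (height u) * g (height (u * a⁻¹)) ∂haarU := by
        -- Right translation by `k * a` moves the average from `f` to `g` and replaces `a` by `a⁻¹`,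
        -- which has the same height; hence the symmetry.
        have : ∀ k : SO2, ∫ u, f (height (u * k * a)) * g (height u) ∂haarU =
            ∫ u, f (height u) * g (height (u * a⁻¹)) ∂haarU := fun k => by
          rw [← integral_mul_right_eq_self (μ := haarU)
            (fun u => f (height u) * g (height (u * a⁻¹))) ((k : SU2) * a)]
          congr 1
          ext u
          rw [← mul_assoc, mul_inv_cancel_right, height_mul_right]
        simp [this]
    _ = ∫ k : SO2, ∫ u, f (height u) * g (height (u * k * a⁻¹)) ∂haarU ∂haarK := by
        have : ∀ k : SO2, ∫ u, f (height u) * g (height (u * k * a⁻¹)) ∂haarU =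
            ∫ u, f (height u) * g (height (u * a⁻¹)) ∂haarU := fun k => by
          rw [← integral_mul_right_eq_self (μ := haarU)
            (fun u => f (height u) * g (height (u * a⁻¹))) (k : SU2)]
          simp_rw [height_mul_right]
        simp [this]
    _ = ∫ u, ∫ k : SO2, f (height u) * g (height (u * k * a⁻¹)) ∂haarK ∂haarU :=
        (integral_integral_swap (f := fun u (k : SO2) => f (height u) * g (height (u * k * a⁻¹)))
          (hint ((hfh.comp continuous_fst).mul (hgh.comp hcont')))).symm
    _ = _ := by
        simp_rw [← hca, ← height_inv a, integral_circleLaw hg, integral_const_mul]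

/-! ### Spherical means on polynomials and their eigenvalues -/

open Polynomial

theorem integrable_angleMeasure {E : Type*} [NormedAddCommGroup E] {f : ℝ → E}
    (hf : Continuous f) : Integrable f angleMeasure := by
  refine Integrable.smul_measure ?_ ENNReal.ofReal_ne_top
  exact (hf.integrableOn_Icc (a := 0) (b := 2 * Real.pi)).mono_set Set.Ioc_subset_Icc_self

/-- The moments of the arcsine law. -/
noncomputable def cosMoment (j : ℕ) : ℝ := ∫ t, Real.cos (2 * t) ^ j ∂angleMeasure

theorem cosMoment_zero : cosMoment 0 = 1 := by simp [cosMoment]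

theorem cosMoment_odd (j : ℕ) : cosMoment (2 * j + 1) = 0 := by
  have hper : Function.Periodic (fun t => Real.cos (2 * t) ^ (2 * j + 1)) (2 * Real.pi) :=
    fun t => by
      simp only
      rw [show 2 * (t + 2 * Real.pi) = 2 * t + 2 * Real.pi + 2 * Real.pi by ring,
        Real.cos_add_two_pi, Real.cos_add_two_pi]
  have h := integral_angleMeasure_add hper (Real.pi / 2)
  have h' : ∀ t, Real.cos (2 * (t + Real.pi / 2)) ^ (2 * j + 1) =
      -Real.cos (2 * t) ^ (2 * j + 1) := fun t => by
    rw [show 2 * (t + Real.pi / 2) = 2 * t + Real.pi by ring, Real.cos_add_pi,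
      Odd.neg_pow ⟨j, rfl⟩]
  simp_rw [h', integral_neg] at h
  change -cosMoment _ = cosMoment _ at h
  linarith

theorem cosMoment_two : cosMoment 2 = 1 / 2 := by
  have hper : Function.Periodic (fun t => Real.cos (2 * t) ^ 2) (2 * Real.pi) := fun t => by
    simp only
    rw [show 2 * (t + 2 * Real.pi) = 2 * t + 2 * Real.pi + 2 * Real.pi by ring,
      Real.cos_add_two_pi, Real.cos_add_two_pi]
  have h := integral_angleMeasure_add hper (Real.pi / 4)
  have h' : ∀ t, Real.cos (2 * (t + Real.pi / 4)) ^ 2 = 1 - Real.cos (2 * t) ^ 2 := fun t => by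
    rw [show 2 * (t + Real.pi / 4) = 2 * t + Real.pi / 2 by ring, Real.cos_add_pi_div_two, neg_sq,
      Real.sin_sq]
  simp_rw [h'] at h
  rw [integral_sub (integrable_const _) (integrable_angleMeasure (by fun_prop))] at h
  change _ - cosMoment 2 = cosMoment 2 at h
  simp at h
  linarith

/-- The image of `X ^ k` under averaging with `circleLaw c`. -/
noncomputable def circleMonomial (c : ℝ) (k : ℕ) : ℝ[X] :=
  ∑ j ∈ Finset.range (k + 1),
    C (k.choose j * cosMoment j * (c ^ (k - j) * (1 - c ^ 2) ^ (j / 2))) *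
      (X ^ (k - j) * (1 - X ^ 2) ^ (j / 2))

/-- Averaging with `circleLaw c`, as an operator on polynomials. -/
noncomputable def circleOp (c : ℝ) : ℝ[X] →ₗ[ℝ] ℝ[X] :=
  Polynomial.lsum fun k => LinearMap.toSpanSingleton ℝ ℝ[X] (circleMonomial c k)

theorem circleOp_monomial (c : ℝ) (k : ℕ) (r : ℝ) :
    circleOp c (monomial k r) = r • circleMonomial c k := by
  change (monomial k r).sum _ = _
  rw [sum_monomial_index] <;> simp

theorem integral_circleLaw_eq {f : ℝ → ℝ} (hf : Continuous f) (c z : ℝ) :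
    ∫ y, f y ∂circleLaw c z =
      ∫ t, f (c * z - √(1 - c ^ 2) * √(1 - z ^ 2) * Real.cos (2 * t)) ∂angleMeasure := by
  rw [circleLaw, integral_map (measurable_circleLaw_map c z).aemeasurable hf.aestronglyMeasurable]

theorem integrable_circleLaw {f : ℝ → ℝ} (hf : Continuous f) (c z : ℝ) :
    Integrable f (circleLaw c z) := by
  rw [circleLaw, integrable_map_measure hf.aestronglyMeasurable
    (measurable_circleLaw_map c z).aemeasurable]
  exact integrable_angleMeasure (hf.comp (by fun_prop))

/-- Binomial expansion in the cosine. Odd powers integrate to zero, so the square roots occur only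
to even powers and the result is polynomial in `z`; rounding in `j / 2` is harmless for the same
reason. -/
theorem eval_circleMonomial {c z : ℝ} (hc : c ∈ Set.Icc (-1 : ℝ) 1) (hz : z ∈ Set.Icc (-1 : ℝ) 1)
    (k : ℕ) : (circleMonomial c k).eval z = ∫ y, y ^ k ∂circleLaw c z := by
  have hc' : 0 ≤ 1 - c ^ 2 := by nlinarith [hc.1, hc.2]
  have hz' : 0 ≤ 1 - z ^ 2 := by nlinarith [hz.1, hz.2]
  rw [integral_circleLaw_eq (by fun_prop)]
  set s := √(1 - c ^ 2) * √(1 - z ^ 2) with hs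
  have hs2 : s ^ 2 = (1 - c ^ 2) * (1 - z ^ 2) := by
    rw [hs, mul_pow, Real.sq_sqrt hc', Real.sq_sqrt hz']
  have hexp : ∀ t, (c * z - s * Real.cos (2 * t)) ^ k = ∑ j ∈ Finset.range (k + 1),
      (-s) ^ j * (c * z) ^ (k - j) * k.choose j * Real.cos (2 * t) ^ j := fun t => by
    rw [sub_eq_add_neg, add_comm, add_pow]
    refine Finset.sum_congr rfl fun j _ => ?_
    rw [← neg_mul, mul_pow]
    ring
  simp_rw [hexp]
  rw [integral_finsetSum _ fun j _ => integrable_angleMeasure (by fun_prop), circleMonomial,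
    eval_finsetSum]
  refine Finset.sum_congr rfl fun j _ => ?_
  rw [integral_const_mul]
  change _ = _ * cosMoment j
  rcases Nat.even_or_odd' j with ⟨i, rfl | rfl⟩
  · rw [Nat.mul_div_cancel_left _ two_pos, pow_mul (-s), neg_sq, hs2, mul_pow, mul_pow]
    simp only [eval_mul, eval_C, eval_pow, eval_sub, eval_X, eval_one]
    ring
  · rw [cosMoment_odd]
    simp

theorem eval_circleOp {c z : ℝ} (hc : c ∈ Set.Icc (-1 : ℝ) 1) (hz : z ∈ Set.Icc (-1 : ℝ) 1)
    (p : ℝ[X]) : (circleOp c p).eval z = ∫ y, p.eval y ∂circleLaw c z := by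
  induction p using Polynomial.induction_on' with
  | add p q hp hq =>
    rw [map_add, eval_add, hp, hq, ← integral_add (integrable_circleLaw p.continuous c z)
      (integrable_circleLaw q.continuous c z)]
    simp only [eval_add]
  | monomial k r =>
    simp only [circleOp_monomial, eval_smul, eval_circleMonomial hc hz, smul_eq_mul,
      eval_monomial, integral_const_mul]

/-- The eigenvalue of `circleOp c` on the Legendre polynomial of degree `k`. -/
noncomputable def circleEigenvalue (c : ℝ) (k : ℕ) : ℝ :=
  ∑ j ∈ Finset.range (k + 1),
    k.choose j * cosMoment j * (c ^ (k - j) * (1 - c ^ 2) ^ (j / 2)) * (-1) ^ (j / 2)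

theorem natDegree_one_sub_X_sq_pow_le (i : ℕ) : ((1 - X ^ 2 : ℝ[X]) ^ i).natDegree ≤ i * 2 := by
  refine natDegree_pow_le_of_le i ?_
  compute_degree

theorem coeff_one_sub_X_sq_pow (i : ℕ) : ((1 - X ^ 2 : ℝ[X]) ^ i).coeff (i * 2) = (-1) ^ i := by
  have h : (1 - X ^ 2 : ℝ[X]).natDegree ≤ 2 := by compute_degree
  rw [coeff_pow_of_natDegree_le h]
  congr 1
  simp [coeff_one]

theorem natDegree_circleMonomial_le (c : ℝ) (k : ℕ) : (circleMonomial c k).natDegree ≤ k := by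
  refine natDegree_sum_le_of_forall_le _ _ fun j hj => ?_
  refine (natDegree_C_mul_le _ _).trans (natDegree_mul_le.trans ?_)
  have h1 := natDegree_one_sub_X_sq_pow_le (j / 2)
  have h2 : (X ^ (k - j) : ℝ[X]).natDegree ≤ k - j := natDegree_X_pow_le _
  have := Finset.mem_range.1 hj
  omega

theorem coeff_circleMonomial (c : ℝ) (k : ℕ) :
    (circleMonomial c k).coeff k = circleEigenvalue c k := by
  rw [circleMonomial, finsetSum_coeff, circleEigenvalue]
  refine Finset.sum_congr rfl fun j hj => ?_
  have hjk := Finset.mem_range.1 hj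
  rw [coeff_C_mul]
  rcases Nat.even_or_odd' j with ⟨i, rfl | rfl⟩
  · congr 1
    rw [Nat.mul_div_cancel_left _ two_pos, coeff_X_pow_mul', if_pos (by omega),
      show k - (k - 2 * i) = i * 2 by omega, coeff_one_sub_X_sq_pow]
  · rw [cosMoment_odd]
    simp

theorem natDegree_circleOp_le (c : ℝ) {n : ℕ} {p : ℝ[X]} (hp : p.natDegree ≤ n) :
    (circleOp c p).natDegree ≤ n := by
  rw [p.as_sum_range' (n + 1) (by omega), map_sum]
  refine natDegree_sum_le_of_forall_le _ _ fun k hk => ?_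
  rw [circleOp_monomial]
  have := Finset.mem_range.1 hk
  exact (natDegree_smul_le _ _).trans ((natDegree_circleMonomial_le c k).trans (by omega))

/-- The operator is triangular in the monomial basis, with the numbers `circleEigenvalue c n` on the
diagonal. -/
theorem coeff_circleOp (c : ℝ) {n : ℕ} {p : ℝ[X]} (hp : p.natDegree ≤ n) :
    (circleOp c p).coeff n = circleEigenvalue c n * p.coeff n := by
  rw [p.as_sum_range' (n + 1) (by omega), map_sum, Finset.sum_range_succ,
    Finset.sum_range_succ, coeff_add, coeff_add,
    circleOp_monomial, coeff_smul, coeff_circleMonomial]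
  have h1 : (∑ k ∈ Finset.range n, circleOp c (monomial k (p.coeff k))).coeff n = 0 := by
    rw [finsetSum_coeff]
    refine Finset.sum_eq_zero fun k hk => ?_
    rw [circleOp_monomial, coeff_smul, coeff_eq_zero_of_natDegree_lt (p := circleMonomial c k)
      ((natDegree_circleMonomial_le c k).trans_lt (Finset.mem_range.1 hk)), smul_zero]
  have h2 : (∑ k ∈ Finset.range n, monomial k (p.coeff k)).coeff n = 0 := by
    rw [finsetSum_coeff]
    refine Finset.sum_eq_zero fun k hk => ?_
    rw [coeff_monomial, if_neg (Finset.mem_range.1 hk).ne]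
  rw [h1, h2, coeff_monomial, if_pos rfl]
  simp [mul_comm]

/-- Laplace's integral for the classical Legendre polynomial at `c`. The factors `(-1) ^ (j / 2)`,
leading coefficients of powers of `1 - X ^ 2`, are the even powers of the imaginary unit. -/
theorem circleEigenvalue_eq_integral {c : ℝ} (hc : c ∈ Set.Icc (-1 : ℝ) 1) (k : ℕ) :
    (circleEigenvalue c k : ℂ) =
      ∫ t, ((c : ℂ) + √(1 - c ^ 2) * Complex.I * Real.cos (2 * t)) ^ k ∂angleMeasure := by
  have hc' : 0 ≤ 1 - c ^ 2 := by nlinarith [hc.1, hc.2]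
  set s := √(1 - c ^ 2) with hs
  have hs2 : ((s : ℂ) * Complex.I) ^ 2 = (1 - (c : ℂ) ^ 2) * (-1) := by
    rw [mul_pow, Complex.I_sq, ← Complex.ofReal_pow, hs, Real.sq_sqrt hc']
    push_cast
    ring
  have hexp : ∀ t : ℝ, ((c : ℂ) + s * Complex.I * Real.cos (2 * t)) ^ k =
      ∑ j ∈ Finset.range (k + 1), (s * Complex.I) ^ j * (c : ℂ) ^ (k - j) * k.choose j *
        ((Real.cos (2 * t) ^ j : ℝ) : ℂ) := fun t => by
    rw [add_comm, add_pow]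
    refine Finset.sum_congr rfl fun j _ => ?_
    rw [mul_pow, Complex.ofReal_pow]
    ring
  simp_rw [hexp]
  rw [integral_finsetSum _ fun j _ => integrable_angleMeasure (by fun_prop), circleEigenvalue,
    Complex.ofReal_sum]
  refine Finset.sum_congr rfl fun j _ => ?_
  have hint : ∫ t, ((Real.cos (2 * t) ^ j : ℝ) : ℂ) ∂angleMeasure = (cosMoment j : ℝ) :=
    integral_ofReal
  rw [integral_const_mul, hint]
  rcases Nat.even_or_odd' j with ⟨i, rfl | rfl⟩
  · rw [Nat.mul_div_cancel_left _ two_pos, pow_mul ((s : ℂ) * Complex.I), hs2, mul_pow]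
    push_cast
    ring
  · rw [cosMoment_odd]
    simp

/-! ### Decay of the eigenvalues -/

/-- Jordan's inequality `|sin x| ≥ (2 / π) |x|` on `[-π/2, π/2]` gives comparison with a Gaussian
integral; the constant comes out below `1` because `π ≤ 4`. -/
theorem integral_exp_neg_sin_sq_le {A : ℝ} (hA : 0 < A) :
    ∫ t, Real.exp (-A * Real.sin (2 * t) ^ 2) ∂angleMeasure ≤ 1 / √A := by
  have hpi := Real.pi_pos
  set g : ℝ → ℝ := fun x => Real.exp (-A * Real.sin x ^ 2) with hg
  have hgc : Continuous g := by fun_prop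
  have hgp : Function.Periodic g Real.pi := fun x => by simp [hg, Real.sin_add_pi]
  have h1 : ∫ t, Real.exp (-A * Real.sin (2 * t) ^ 2) ∂angleMeasure =
      Real.pi⁻¹ * ∫ x in (-(Real.pi / 2))..(Real.pi / 2), g x := by
    rw [integral_angleMeasure]
    have e1 : ∫ t in (0 : ℝ)..2 * Real.pi, g (2 * t) =
        (2 : ℝ)⁻¹ • ∫ x in (2 * 0)..(2 * (2 * Real.pi)), g x :=
      intervalIntegral.integral_comp_mul_left g two_ne_zero
    -- The variable `2 * t` runs over `[0, 4π]`, four periods of `sin ^ 2`; one period is then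
    -- recentred at `0`.
    have e2 := hgp.intervalIntegral_add_zsmul_eq 4 0 fun _ _ => hgc.intervalIntegrable _ _
    have e3 := hgp.intervalIntegral_add_eq 0 (-(Real.pi / 2))
    rw [show -(Real.pi / 2) + Real.pi = Real.pi / 2 by ring] at e3
    rw [e3] at e2
    rw [show (0 : ℝ) + (4 : ℤ) • Real.pi = 2 * (2 * Real.pi) by simp; ring] at e2
    rw [mul_zero, e2] at e1
    change (2 * Real.pi)⁻¹ • ∫ t in (0 : ℝ)..2 * Real.pi, g (2 * t) = _
    rw [e1]
    simp only [smul_eq_mul, zsmul_eq_mul]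
    field_simp
    norm_num
  have hb : 0 < A * (2 / Real.pi) ^ 2 := by positivity
  have h2 : ∫ x in (-(Real.pi / 2))..(Real.pi / 2), g x ≤
      √(Real.pi / (A * (2 / Real.pi) ^ 2)) := by
    rw [← integral_gaussian, intervalIntegral.integral_of_le (by linarith)]
    have hgi := integrable_exp_neg_mul_sq hb
    refine (setIntegral_mono_on (hgc.integrableOn_Icc.mono_set Set.Ioc_subset_Icc_self)
      hgi.integrableOn measurableSet_Ioc fun x hx => ?_).trans
      (setIntegral_le_integral hgi (Filter.Eventually.of_forall fun x => (Real.exp_pos _).le))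
    refine Real.exp_le_exp.2 ?_
    have := Real.mul_abs_le_abs_sin (x := x) (abs_le.2 ⟨hx.1.le, hx.2⟩)
    have h3 : (2 / Real.pi * |x|) ^ 2 ≤ |Real.sin x| ^ 2 :=
      pow_le_pow_left₀ (by positivity) this 2
    rw [mul_pow, sq_abs, sq_abs] at h3
    nlinarith
  rw [h1]
  refine (mul_le_mul_of_nonneg_left h2 (by positivity)).trans ?_
  have h4 : Real.pi / (A * (2 / Real.pi) ^ 2) ≤ (Real.pi * (1 / √A)) ^ 2 := by
    have h34 := Real.pi_le_four
    rw [mul_pow, div_pow 1, Real.sq_sqrt hA.le]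
    field_simp
    linarith
  calc Real.pi⁻¹ * √(Real.pi / (A * (2 / Real.pi) ^ 2)) ≤
      Real.pi⁻¹ * (Real.pi * (1 / √A)) := by
        gcongr
        exact Real.sqrt_le_iff.2 ⟨by positivity, h4⟩
    _ = 1 / √A := by field_simp

/-- The squared norm equals `1 - (1 - c ^ 2) * sin x ^ 2`, and `1 - y ≤ exp (-y)`. -/
theorem norm_circleIntegrand_le {c : ℝ} (hc : c ∈ Set.Icc (-1 : ℝ) 1) (x : ℝ) :
    ‖(c : ℂ) + √(1 - c ^ 2) * Complex.I * Real.cos x‖ ≤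
      Real.exp (-((1 - c ^ 2) / 2) * Real.sin x ^ 2) := by
  have hc' : 0 ≤ 1 - c ^ 2 := by nlinarith [hc.1, hc.2]
  have h : ‖(c : ℂ) + √(1 - c ^ 2) * Complex.I * Real.cos x‖ ^ 2 =
      1 - (1 - c ^ 2) * Real.sin x ^ 2 := by
    have : (c : ℂ) + √(1 - c ^ 2) * Complex.I * Real.cos x = ⟨c, √(1 - c ^ 2) * Real.cos x⟩ := by
      apply Complex.ext <;> simp [-Complex.ofReal_cos]
    rw [this, ← Complex.normSq_eq_norm_sq, Complex.normSq_mk, Real.sin_sq]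
    linear_combination Real.cos x ^ 2 * Real.sq_sqrt hc'
  refine (pow_le_pow_iff_left₀ (norm_nonneg _) (Real.exp_pos _).le two_ne_zero).1 ?_
  rw [h, ← Real.exp_nat_mul]
  refine (le_of_eq ?_).trans (Real.add_one_le_exp _)
  push_cast
  ring

theorem abs_circleEigenvalue_le_one {c : ℝ} (hc : c ∈ Set.Icc (-1 : ℝ) 1) (k : ℕ) :
    |circleEigenvalue c k| ≤ 1 := by
  rw [← Real.norm_eq_abs, ← Complex.norm_real, circleEigenvalue_eq_integral hc]
  have := norm_integral_le_of_norm_le_const (μ := angleMeasure) (C := 1)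
    (f := fun t => ((c : ℂ) + √(1 - c ^ 2) * Complex.I * Real.cos (2 * t)) ^ k)
    (Filter.Eventually.of_forall fun t => by
      rw [norm_pow]
      refine pow_le_one₀ (norm_nonneg _) ((norm_circleIntegrand_le hc _).trans ?_)
      rw [Real.exp_le_one_iff]
      have hc' : 0 ≤ 1 - c ^ 2 := by nlinarith [hc.1, hc.2]
      have := sq_nonneg (Real.sin (2 * t))
      nlinarith [mul_nonneg hc' this])
  simpa using this

theorem abs_circleEigenvalue_le {c : ℝ} (hc : c ^ 2 < 1) {k : ℕ} (hk : 0 < k) :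
    |circleEigenvalue c k| ≤ 1 / √(k * ((1 - c ^ 2) / 2)) := by
  have hk' : (0 : ℝ) < k := Nat.cast_pos.2 hk
  have hc' : c ∈ Set.Icc (-1 : ℝ) 1 := ⟨by nlinarith, by nlinarith⟩
  rw [← Real.norm_eq_abs, ← Complex.norm_real, circleEigenvalue_eq_integral hc']
  refine le_trans ?_ (integral_exp_neg_sin_sq_le (A := k * ((1 - c ^ 2) / 2)) (by
    have : 0 < 1 - c ^ 2 := by linarith
    positivity))
  refine norm_integral_le_of_norm_le (integrable_angleMeasure (by fun_prop))
    (Filter.Eventually.of_forall fun t => ?_)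
  rw [norm_pow]
  refine (pow_le_pow_left₀ (norm_nonneg _) (norm_circleIntegrand_le hc' _) k).trans_eq ?_
  rw [← Real.exp_nat_mul]
  congr 1
  ring

/-! ### The height is uniformly distributed under Haar measure -/

/-- The uniform probability measure on `(-1, 1]`. -/
noncomputable def uniformMeasure : Measure ℝ :=
  ENNReal.ofReal 2⁻¹ • volume.restrict (Set.Ioc (-1) 1)

instance : IsProbabilityMeasure uniformMeasure := ⟨by
  rw [uniformMeasure, Measure.smul_apply, Measure.restrict_apply_univ, Real.volume_Ioc,
    smul_eq_mul, ← ENNReal.ofReal_mul (by positivity)]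
  norm_num⟩

theorem integral_uniformMeasure (f : ℝ → ℝ) :
    ∫ t, f t ∂uniformMeasure = 2⁻¹ * ∫ t in (-1 : ℝ)..1, f t := by
  rw [uniformMeasure, integral_smul_measure, intervalIntegral.integral_of_le (by norm_num),
    ENNReal.toReal_ofReal (by positivity), smul_eq_mul]

theorem uniformMeasure_compl_Icc : uniformMeasure (Set.Icc (-1 : ℝ) 1)ᶜ = 0 := by
  rw [uniformMeasure, Measure.smul_apply, Measure.restrict_apply measurableSet_Icc.compl,
    Set.disjoint_iff_inter_eq_empty.1
      ((Set.disjoint_compl_left_iff_subset).2 Set.Ioc_subset_Icc_self)]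
  simp

/-- Integrability of continuous functions for finite measures carried by `[-1, 1]`. -/
theorem integrable_of_compl_Icc {μ : Measure ℝ} [IsFiniteMeasure μ]
    (hμ : μ (Set.Icc (-1 : ℝ) 1)ᶜ = 0) {f : ℝ → ℝ} (hf : Continuous f) : Integrable f μ := by
  obtain ⟨M, hM⟩ := isCompact_Icc.exists_bound_of_continuousOn (s := Set.Icc (-1 : ℝ) 1)
    hf.continuousOn
  refine Integrable.of_bound hf.aestronglyMeasurable M ?_
  filter_upwards [compl_mem_ae_iff.2 hμ] with x hx
  exact hM x (by simpa using hx)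

/-- A finite measure carried by `[-1, 1]` is determined by its moments. -/
theorem ext_of_integral_eval_eq {μ ν : Measure ℝ} [IsFiniteMeasure μ] [IsFiniteMeasure ν]
    (hμ : μ (Set.Icc (-1 : ℝ) 1)ᶜ = 0) (hν : ν (Set.Icc (-1 : ℝ) 1)ᶜ = 0)
    (h : ∀ p : ℝ[X], ∫ x, p.eval x ∂μ = ∫ x, p.eval x ∂ν) : μ = ν := by
  refine ext_of_forall_integral_eq_of_IsFiniteMeasure fun f => ?_
  have key : ∀ ρ : Measure ℝ, IsFiniteMeasure ρ → ρ (Set.Icc (-1 : ℝ) 1)ᶜ = 0 →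
      ∀ (p : ℝ[X]) (ε : ℝ), (∀ x ∈ Set.Icc (-1 : ℝ) 1, |p.eval x - f x| < ε) →
      |∫ x, p.eval x ∂ρ - ∫ x, f x ∂ρ| ≤ ε * ρ.real Set.univ := by
    intro ρ hfin hρ p ε hp
    have hi1 : Integrable (fun x => p.eval x) ρ := integrable_of_compl_Icc hρ p.continuous
    have hi2 : Integrable (fun x => f x) ρ := integrable_of_compl_Icc hρ f.continuous
    rw [← integral_sub hi1 hi2, ← Real.norm_eq_abs]
    refine norm_integral_le_of_norm_le_const ?_
    filter_upwards [compl_mem_ae_iff.2 hρ] with x hx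
    exact (hp x (by simpa using hx)).le
  set R := μ.real Set.univ + ν.real Set.univ + 1
  have hR : 0 < R := by positivity
  refine eq_of_abs_sub_le_all fun ε hε => ?_
  obtain ⟨p, hp⟩ := exists_polynomial_near_of_continuousOn (-1) 1 f f.continuous.continuousOn
    (ε / R) (by positivity)
  have h1 := key μ inferInstance hμ p _ hp
  have h2 := key ν inferInstance hν p _ hp
  rw [h p] at h1
  calc |∫ x, f x ∂μ - ∫ x, f x ∂ν|
      = |(∫ x, p.eval x ∂ν - ∫ x, f x ∂ν) - (∫ x, p.eval x ∂ν - ∫ x, f x ∂μ)| := by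
        congr 1; ring
    _ ≤ ε / R * ν.real Set.univ + ε / R * μ.real Set.univ :=
        (abs_sub _ _).trans (add_le_add h2 h1)
    _ ≤ ε / R * R := by
        rw [← mul_add]
        gcongr
        simp only [R]
        linarith
    _ = ε := by field_simp

instance (ν : Measure SU2) [IsProbabilityMeasure ν] : IsProbabilityMeasure (ν.map height) :=
  Measure.isProbabilityMeasure_map measurable_height.aemeasurable

theorem map_height_compl_Icc (ν : Measure SU2) : ν.map height (Set.Icc (-1 : ℝ) 1)ᶜ = 0 := by
  rw [Measure.map_apply measurable_height measurableSet_Icc.compl]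
  have : height ⁻¹' (Set.Icc (-1 : ℝ) 1)ᶜ = ∅ := by
    ext u
    simpa using height_mem_Icc u
  rw [this, measure_empty]

/-- The moments of the law of `height` under the Haar measure. -/
noncomputable def heightMoment (n : ℕ) : ℝ := ∫ u, height u ^ n ∂haarU

theorem integrable_polynomial_height (p : ℝ[X]) : Integrable (fun u => p.eval (height u)) haarU :=
  integrable_of_continuous (p.continuous.comp continuous_height) _

theorem integral_circleMonomial_height {c : ℝ} (hc : c ∈ Set.Icc (-1 : ℝ) 1) (n : ℕ) :
    ∫ u, (circleMonomial c n).eval (height u) ∂haarU = heightMoment n := by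
  have h := integral_circleLaw_mul_comm hc (continuous_pow n) (continuous_const (y := (1 : ℝ)))
  simp only [mul_one, integral_const, probReal_univ, smul_eq_mul] at h
  rw [heightMoment, ← h]
  congr 1
  ext u
  rw [eval_circleMonomial hc (height_mem_Icc u)]

theorem heightMoment_one : heightMoment 1 = 0 := by
  have h := integral_circleMonomial_height (c := 0) (by simp) 1
  have h1 := cosMoment_odd 0
  rw [mul_zero, zero_add] at h1
  simp [circleMonomial, Finset.sum_range_succ, h1] at h
  exact h.symm

/-- Averaging over circles preserves the height moment for every radius. The averaged moment is a
polynomial in `c`, constant on `[-1, 1]`, so its derivative at `c = 1` vanishes; that equation is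
the recursion. -/
theorem heightMoment_add_two (n : ℕ) :
    (n + 3 : ℝ) * heightMoment (n + 2) = (n + 1) * heightMoment n := by
  set a : ℕ → ℝ := fun j => (n + 2).choose j * cosMoment j *
    ∫ u, height u ^ (n + 2 - j) * (1 - height u ^ 2) ^ (j / 2) ∂haarU with ha
  set Q : ℝ[X] := ∑ j ∈ Finset.range (n + 2 + 1),
    C (a j) * (X ^ (n + 2 - j) * (1 - X ^ 2) ^ (j / 2)) with hQ
  have hQc : ∀ c ∈ Set.Icc (-1 : ℝ) 1, Q.eval c = (C (heightMoment (n + 2))).eval c := by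
    intro c hc
    rw [eval_C, ← integral_circleMonomial_height hc, hQ, eval_finsetSum]
    simp only [circleMonomial, eval_finsetSum]
    rw [integral_finsetSum _ fun j _ => integrable_polynomial_height _]
    refine Finset.sum_congr rfl fun j _ => ?_
    simp only [eval_mul, eval_C, eval_pow, eval_sub, eval_X, eval_one, ha, integral_const_mul]
    ring
  have hQ' : Q = C (heightMoment (n + 2)) :=
    eq_of_infinite_eval_eq _ _ ((Set.Icc_infinite (by norm_num : (-1 : ℝ) < 1)).mono hQc)
  have hd : (derivative Q).eval 1 = 0 := by rw [hQ']; simp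
  have hterm : ∀ j, (derivative (C (a j) * (X ^ (n + 2 - j) * (1 - X ^ 2) ^ (j / 2)))).eval 1 =
      a j * (((n + 2 - j : ℕ) : ℝ) * 0 ^ (j / 2) + ((j / 2 : ℕ) : ℝ) * 0 ^ (j / 2 - 1) * (-2)) := by
    intro j
    simp [derivative_mul, derivative_pow]
  rw [hQ, derivative_sum, eval_finsetSum] at hd
  simp_rw [hterm] at hd
  -- At `c = 1` the even terms from `j = 4` on still contain a factor `1 - c ^ 2` after
  -- differentiation, and odd terms vanish with their cosine moments. Only `j = 0` and `j = 2`
  -- contribute.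
  rw [Finset.sum_range_succ', Finset.sum_range_succ', Finset.sum_range_succ',
    Finset.sum_eq_zero] at hd
  · have h1 : a 1 = 0 := by
      have := cosMoment_odd 0
      rw [mul_zero, zero_add] at this
      simp [ha, this]
    have h0 : a 0 = heightMoment (n + 2) := by
      simp [ha, cosMoment_zero, heightMoment]
    have h2 : a 2 = (n + 2) * (n + 1) / 4 * (heightMoment n - heightMoment (n + 2)) := by
      have : ∫ u, height u ^ n * (1 - height u ^ 2) ∂haarU =
          heightMoment n - heightMoment (n + 2) := by
        have hi : ∀ k, Integrable (fun u => height u ^ k) haarU := fun k =>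
          integrable_of_continuous (continuous_height.pow k) _
        rw [heightMoment, heightMoment, ← integral_sub (hi n) (hi (n + 2))]
        congr 1
        ext u
        ring
      simp only [ha, cosMoment_two, Nat.add_sub_cancel, Nat.div_self two_pos, pow_one, this]
      rw [Nat.cast_choose_two]
      push_cast
      ring
    simp only [zero_add, Nat.reduceAdd] at hd
    rw [h1, h0, h2] at hd
    norm_num at hd
    have hn : (n + 2 : ℝ) ≠ 0 := by positivity
    refine mul_left_cancel₀ hn ?_
    linear_combination 2 * hd
  · intro j _
    simp only [add_assoc, Nat.reduceAdd]
    rcases Nat.even_or_odd' (j + 3) with ⟨i, hi | hi⟩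
    · rw [hi, Nat.mul_div_cancel_left _ two_pos, zero_pow (by omega), zero_pow (by omega)]
      simp
    · have : a (j + 3) = 0 := by
        simp only [ha]
        rw [hi, cosMoment_odd]
        simp
      rw [this, zero_mul]

theorem heightMoment_eq (n : ℕ) : heightMoment n = ∫ x, x ^ n ∂uniformMeasure := by
  have hU : ∀ k : ℕ, ∫ x, x ^ k ∂uniformMeasure = 2⁻¹ * ((1 - (-1) ^ (k + 1)) / (k + 1)) := by
    intro k
    rw [integral_uniformMeasure, integral_pow, one_pow]
  induction n using Nat.twoStepInduction with
  | zero => rw [hU]; norm_num [heightMoment]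
  | one => rw [hU, heightMoment_one]; norm_num
  | more n ih _ =>
    have h := heightMoment_add_two n
    rw [ih, hU] at h
    rw [hU]
    have h1 : (n + 1 : ℝ) ≠ 0 := by positivity
    have h3 : (n + 3 : ℝ) ≠ 0 := by positivity
    refine mul_left_cancel₀ h3 (h.trans ?_)
    push_cast
    rw [show (n : ℝ) + 2 + 1 = n + 3 by ring]
    field_simp
    ring

theorem map_height_haarU : haarU.map height = uniformMeasure := by
  refine ext_of_integral_eval_eq (map_height_compl_Icc _) uniformMeasure_compl_Icc fun p => ?_
  rw [integral_map measurable_height.aemeasurable p.continuous.aestronglyMeasurable]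
  induction p using Polynomial.induction_on' with
  | add p q hp hq =>
    simp only [eval_add]
    rw [integral_add (integrable_polynomial_height p) (integrable_polynomial_height q), hp, hq,
      integral_add (integrable_of_compl_Icc uniformMeasure_compl_Icc p.continuous)
        (integrable_of_compl_Icc uniformMeasure_compl_Icc q.continuous)]
  | monomial k r =>
    simp only [eval_monomial, integral_const_mul]
    rw [← heightMoment_eq, heightMoment]

theorem measurePreserving_height : MeasurePreserving height haarU uniformMeasure :=
  ⟨measurable_height, map_height_haarU⟩

/-! ### Legendre polynomials as eigenfunctions -/

theorem integrable_eval_uniformMeasure (p : ℝ[X]) :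
    Integrable (fun x => p.eval x) uniformMeasure :=
  integrable_of_compl_Icc uniformMeasure_compl_Icc p.continuous

theorem integrable_eval_mul_eval (p q : ℝ[X]) :
    Integrable (fun x => p.eval x * q.eval x) uniformMeasure :=
  integrable_of_compl_Icc uniformMeasure_compl_Icc (p.continuous.mul q.continuous)

/-- The inner product of two polynomials in `L²` of the uniform measure on `[-1, 1]`. -/
noncomputable def polyForm : ℝ[X] →ₗ[ℝ] ℝ[X] →ₗ[ℝ] ℝ :=
  LinearMap.mk₂ ℝ (fun p q => ∫ x, (p * q).eval x ∂uniformMeasure)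
    (fun p p' q => by
      simp only [add_mul, eval_add]
      exact integral_add (integrable_eval_uniformMeasure _) (integrable_eval_uniformMeasure _))
    (fun r p q => by simp [integral_const_mul])
    (fun p q q' => by
      simp only [mul_add, eval_add]
      exact integral_add (integrable_eval_uniformMeasure _) (integrable_eval_uniformMeasure _))
    (fun r p q => by simp [integral_const_mul])

theorem polyForm_apply (p q : ℝ[X]) :
    polyForm p q = ∫ x, p.eval x * q.eval x ∂uniformMeasure := by
  simp [polyForm]

theorem polyForm_comm (p q : ℝ[X]) : polyForm p q = polyForm q p := by
  simp only [polyForm_apply, mul_comm]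

theorem uniformMeasure_absolutelyContinuous : uniformMeasure ≪ volume :=
  (Measure.smul_absolutelyContinuous).trans Measure.restrict_le_self.absolutelyContinuous

theorem polyForm_self_pos {p : ℝ[X]} (hp : p ≠ 0) : 0 < polyForm p p := by
  rw [polyForm_apply]
  have hnn : 0 ≤ fun x => p.eval x * p.eval x := fun x => mul_self_nonneg _
  refine (integral_nonneg hnn).lt_of_ne' fun h0 => ?_
  rw [integral_eq_zero_iff_of_nonneg hnn (integrable_eval_mul_eval p p)] at h0
  have hr : ∀ᵐ x ∂uniformMeasure, x ∉ (p.roots.toFinset : Set ℝ) :=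
    uniformMeasure_absolutelyContinuous.ae_le
      (compl_mem_ae_iff.2 (p.roots.toFinset.finite_toSet.measure_zero volume))
  obtain ⟨x, h1, h2⟩ := (h0.and hr).exists
  refine h2 ?_
  simp only [Pi.zero_apply, mul_self_eq_zero] at h1
  simpa [hp] using h1

/-- Positivity makes the form nondegenerate on polynomials of degree below `n`, so `X ^ n` has an
orthogonal projection there; subtract it. -/
theorem exists_monic_orthogonal (n : ℕ) :
    ∃ q : ℝ[X], q.Monic ∧ q.natDegree = n ∧ ∀ r : ℝ[X], r.degree < n → polyForm q r = 0 := by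
  let W := degreeLT ℝ n
  have : Module.Finite ℝ W := Module.Finite.equiv (degreeLTEquiv ℝ n).symm
  let L : W →ₗ[ℝ] Module.Dual ℝ W := polyForm.domRestrict₁₂ W W
  have hinj : Function.Injective L := by
    rw [injective_iff_map_eq_zero]
    intro r hr
    by_contra hne
    have h := polyForm_self_pos (p := (r : ℝ[X])) (by simpa using hne)
    have h' : L r r = 0 := by rw [hr]; rfl
    exact h.ne' h'
  have hsurj := (LinearMap.injective_iff_surjective_of_finrank_eq_finrank
    (Subspace.dual_finrank_eq (K := ℝ) (V := W)).symm).1 hinj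
  obtain ⟨r, hr⟩ := hsurj ((polyForm (X ^ n)).domRestrict W)
  have hdeg : (r : ℝ[X]).degree < (X ^ n : ℝ[X]).degree := by
    rw [degree_X_pow]
    exact mem_degreeLT.1 r.2
  refine ⟨X ^ n - (r : ℝ[X]), (monic_X_pow n).sub_of_left hdeg, ?_, fun s hs => ?_⟩
  · rw [natDegree_eq_of_degree_eq (degree_sub_eq_left_of_degree_lt hdeg), natDegree_X_pow]
  · have := LinearMap.congr_fun hr ⟨s, mem_degreeLT.2 hs⟩
    rw [map_sub, LinearMap.sub_apply, sub_eq_zero]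
    exact this.symm

/-- The monic Legendre polynomial of degree `n`. -/
noncomputable def monicLegendre (n : ℕ) : ℝ[X] := (exists_monic_orthogonal n).choose

theorem monic_monicLegendre (n : ℕ) : (monicLegendre n).Monic :=
  (exists_monic_orthogonal n).choose_spec.1

theorem natDegree_monicLegendre (n : ℕ) : (monicLegendre n).natDegree = n :=
  (exists_monic_orthogonal n).choose_spec.2.1

theorem polyForm_monicLegendre {n : ℕ} {r : ℝ[X]} (hr : r.degree < n) :
    polyForm (monicLegendre n) r = 0 :=
  (exists_monic_orthogonal n).choose_spec.2.2 r hr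

theorem coeff_monicLegendre (n : ℕ) : (monicLegendre n).coeff n = 1 := by
  have h := monic_monicLegendre n
  rwa [Monic, leadingCoeff, natDegree_monicLegendre] at h

theorem degree_lt_of_natDegree_le_of_coeff {n : ℕ} {p : ℝ[X]} (hp : p.natDegree ≤ n)
    (hc : p.coeff n = 0) : p.degree < n := by
  rw [degree_lt_iff_coeff_zero]
  intro m hm
  rcases hm.eq_or_lt with rfl | hm
  · exact hc
  · exact coeff_eq_zero_of_natDegree_lt (hp.trans_lt hm)

theorem polyForm_circleOp_comm {c : ℝ} (hc : c ∈ Set.Icc (-1 : ℝ) 1) (p q : ℝ[X]) :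
    polyForm (circleOp c p) q = polyForm p (circleOp c q) := by
  have h := integral_circleLaw_mul_comm hc p.continuous q.continuous
  have hm : ∀ r s : ℝ[X], polyForm r s = ∫ u, r.eval (height u) * s.eval (height u) ∂haarU := by
    intro r s
    have hrs : Continuous fun x => r.eval x * s.eval x := r.continuous.mul s.continuous
    rw [polyForm_apply, ← map_height_haarU, integral_map measurable_height.aemeasurable
      hrs.aestronglyMeasurable]
  rw [hm, hm]
  simp_rw [eval_circleOp hc (height_mem_Icc _)]
  exact h

/-- The defect `r` has degree below `n`, as does its image. Symmetry of the operator and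
orthogonality of `q` to lower degrees then give `polyForm r r = 0`. -/
theorem circleOp_monicLegendre {c : ℝ} (hc : c ∈ Set.Icc (-1 : ℝ) 1) (n : ℕ) :
    circleOp c (monicLegendre n) = circleEigenvalue c n • monicLegendre n := by
  have hn := (natDegree_monicLegendre n).le
  set q := monicLegendre n with hq
  set r := circleOp c q - circleEigenvalue c n • q with hr
  have hdeg : r.degree < n := by
    refine degree_lt_of_natDegree_le_of_coeff ?_ ?_
    · exact (natDegree_sub_le _ _).trans
        (max_le (natDegree_circleOp_le c hn) ((natDegree_smul_le _ _).trans hn))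
    · rw [hr, coeff_sub, coeff_circleOp c hn, coeff_smul, smul_eq_mul, sub_self]
  have hdeg' : (circleOp c r).degree < n := by
    have hrn := natDegree_le_of_degree_le hdeg.le
    refine degree_lt_of_natDegree_le_of_coeff (natDegree_circleOp_le c hrn) ?_
    rw [coeff_circleOp c hrn, coeff_eq_zero_of_degree_lt hdeg, mul_zero]
  by_contra hne
  have hpos := polyForm_self_pos (p := r) (by rwa [hr, sub_ne_zero])
  have h0 : polyForm r r = 0 := by
    calc polyForm r r = polyForm (circleOp c q) r - circleEigenvalue c n * polyForm q r := by
          conv_lhs => enter [1]; rw [hr, map_sub, map_smul]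
          rfl
      _ = 0 := by
          rw [polyForm_circleOp_comm hc, polyForm_monicLegendre hdeg, polyForm_monicLegendre hdeg']
          simp
  exact hpos.ne' h0

/-- Integrate the derivative of `X * q ^ 2` over `[-1, 1]`. Since `X * q'` and `n * q` differ by
lower degree, this gives `q(1)² + q(-1)² = (4n + 2) ⟨q, q⟩`; discarding `q(-1)²` costs a factor
irrelevant here. -/
theorem eval_one_sq_monicLegendre_le (n : ℕ) :
    (monicLegendre n).eval 1 ^ 2 ≤
      (4 * n + 2) * polyForm (monicLegendre n) (monicLegendre n) := by
  have hn := natDegree_monicLegendre n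
  have hc := coeff_monicLegendre n
  have horth : ∀ r : ℝ[X], r.degree < n → polyForm (monicLegendre n) r = 0 :=
    fun r hr => polyForm_monicLegendre hr
  set q := monicLegendre n
  have h1 : polyForm q (X * derivative q) = n * polyForm q q := by
    have hdeg : (X * derivative q - (n : ℝ) • q).degree < (n : WithBot ℕ) := by
      refine degree_lt_of_natDegree_le_of_coeff ?_ ?_
      · refine (natDegree_sub_le _ _).trans (max_le ?_ ((natDegree_smul_le _ _).trans hn.le))
        refine natDegree_le_iff_coeff_eq_zero.2 fun m hm => ?_
        obtain ⟨m, rfl⟩ := Nat.exists_eq_succ_of_ne_zero (Nat.ne_zero_of_lt hm)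
        rw [Nat.succ_eq_add_one, coeff_X_mul, coeff_derivative,
          coeff_eq_zero_of_natDegree_lt (hn.trans_lt hm), zero_mul]
      · rw [coeff_sub, coeff_smul, hc]
        rcases n with _ | n
        · simp
        · rw [coeff_X_mul, coeff_derivative, hc]
          simp
    have := horth _ hdeg
    rw [map_sub, map_smul, smul_eq_mul] at this
    linarith
  have h2 : ∫ x in (-1 : ℝ)..1, (derivative (X * q ^ 2)).eval x =
      q.eval 1 ^ 2 + q.eval (-1) ^ 2 := by
    rw [intervalIntegral.integral_eq_sub_of_hasDerivAt
      (fun x _ => (X * q ^ 2).hasDerivAt x) ((derivative _).continuous.intervalIntegrable _ _)]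
    simp
  have h3 : 2⁻¹ * ∫ x in (-1 : ℝ)..1, (derivative (X * q ^ 2)).eval x =
      polyForm q q + 2 * polyForm q (X * derivative q) := by
    rw [← integral_uniformMeasure, polyForm_apply, polyForm_apply, ← integral_const_mul,
      ← integral_add]
    · congr 1
      ext x
      simp [derivative_mul, derivative_pow]
      ring
    · exact integrable_eval_mul_eval q q
    · exact (integrable_eval_mul_eval q (X * derivative q)).const_mul 2
  rw [h2, h1] at h3
  nlinarith [sq_nonneg (q.eval (-1))]

/-- The orthonormal Legendre polynomial of degree `n`. -/
noncomputable def legendre (n : ℕ) : ℝ[X] :=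
  (√(polyForm (monicLegendre n) (monicLegendre n)))⁻¹ • monicLegendre n

theorem polyForm_monicLegendre_pos (n : ℕ) : 0 < polyForm (monicLegendre n) (monicLegendre n) :=
  polyForm_self_pos (monic_monicLegendre n).ne_zero

theorem natDegree_legendre_le (n : ℕ) : (legendre n).natDegree ≤ n :=
  (natDegree_smul_le _ _).trans (natDegree_monicLegendre n).le

theorem coeff_legendre_ne_zero (n : ℕ) : (legendre n).coeff n ≠ 0 := by
  rw [legendre, coeff_smul, coeff_monicLegendre, smul_eq_mul, mul_one]
  exact inv_ne_zero (Real.sqrt_pos.2 (polyForm_monicLegendre_pos n)).ne'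

theorem polyForm_legendre_self (n : ℕ) : polyForm (legendre n) (legendre n) = 1 := by
  have h := polyForm_monicLegendre_pos n
  simp only [legendre, map_smul, LinearMap.smul_apply, smul_eq_mul]
  rw [← mul_assoc, ← mul_inv, Real.mul_self_sqrt h.le, inv_mul_cancel₀ h.ne']

theorem polyForm_legendre_of_ne {m n : ℕ} (h : m ≠ n) :
    polyForm (legendre m) (legendre n) = 0 := by
  have key : ∀ {i j : ℕ}, i < j → polyForm (legendre j) (legendre i) = 0 := by
    intro i j hij
    have hd : (legendre i).degree < j := degree_le_natDegree.trans_lt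
      (by exact_mod_cast (natDegree_legendre_le i).trans_lt hij)
    rw [legendre, map_smul, LinearMap.smul_apply, polyForm_monicLegendre hd, smul_zero]
  rcases h.lt_or_gt with h | h
  · rw [polyForm_comm, key h]
  · exact key h

theorem eval_one_sq_legendre_le (n : ℕ) : (legendre n).eval 1 ^ 2 ≤ 4 * n + 2 := by
  have h := polyForm_monicLegendre_pos n
  rw [legendre, eval_smul, smul_eq_mul, mul_pow, inv_pow, Real.sq_sqrt h.le, inv_mul_le_iff₀ h,
    mul_comm]
  exact eval_one_sq_monicLegendre_le n

theorem circleOp_legendre {c : ℝ} (hc : c ∈ Set.Icc (-1 : ℝ) 1) (n : ℕ) :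
    circleOp c (legendre n) = circleEigenvalue c n • legendre n := by
  rw [legendre, map_smul, circleOp_monicLegendre hc, smul_comm]

/-! ### Square-summable Legendre coefficients give `L²` densities -/

theorem memLp_eval_uniformMeasure (p : ℝ[X]) :
    MemLp (fun x => p.eval x) 2 uniformMeasure := by
  rw [memLp_two_iff_integrable_sq p.continuous.aestronglyMeasurable]
  exact integrable_of_compl_Icc uniformMeasure_compl_Icc (p.continuous.pow 2)

/-- The class of a polynomial in `L²` of the uniform measure on `[-1, 1]`. -/
noncomputable def polyLp : ℝ[X] →ₗ[ℝ] Lp ℝ 2 uniformMeasure where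
  toFun p := (memLp_eval_uniformMeasure p).toLp _
  map_add' p q := by
    rw [← MemLp.toLp_add]
    congr 1
    ext x
    simp
  map_smul' r p := by
    rw [RingHom.id_apply, ← MemLp.toLp_const_smul]
    congr 1
    ext x
    simp

theorem inner_polyLp (p : ℝ[X]) (f : Lp ℝ 2 uniformMeasure) :
    inner ℝ (polyLp p) f = ∫ x, p.eval x * f x ∂uniformMeasure := by
  rw [L2.inner_def]
  refine integral_congr_ae ?_
  filter_upwards [(memLp_eval_uniformMeasure p).coeFn_toLp] with x hx
  change inner ℝ ((memLp_eval_uniformMeasure p).toLp _ x) (f x) = _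
  rw [hx]
  simp [mul_comm]

theorem inner_polyLp_polyLp (p q : ℝ[X]) :
    inner ℝ (polyLp p) (polyLp q) = polyForm p q := by
  rw [inner_polyLp, polyForm_apply]
  refine integral_congr_ae ?_
  filter_upwards [(memLp_eval_uniformMeasure q).coeFn_toLp] with x hx
  change _ * (memLp_eval_uniformMeasure q).toLp _ x = _
  rw [hx]

theorem orthonormal_legendre : Orthonormal ℝ fun n => polyLp (legendre n) := by
  rw [orthonormal_iff_ite]
  intro i j
  rw [inner_polyLp_polyLp]
  split_ifs with h
  · rw [h, polyForm_legendre_self]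
  · exact polyForm_legendre_of_ne h

theorem exists_inner_legendre_eq {a : ℕ → ℝ} (ha : Summable fun n => a n ^ 2) :
    ∃ f : Lp ℝ 2 uniformMeasure, ∀ n, inner ℝ (polyLp (legendre n)) f = a n := by
  have hs : Summable fun n => a n • polyLp (legendre n) := by
    have := (orthonormal_legendre.orthogonalFamily.summable_iff_norm_sq_summable a).2
      (by simpa using ha)
    simpa using this
  refine ⟨∑' n, a n • polyLp (legendre n), fun n => ?_⟩
  have h := hs.hasSum.mapL (innerSL ℝ (polyLp (legendre n)))
  refine h.unique ?_
  have h' := hasSum_single (f := fun m => innerSL ℝ (polyLp (legendre n))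
    (a m • polyLp (legendre m))) n fun m hm => by
      simp only [innerSL_apply_apply, inner_smul_right, inner_polyLp_polyLp,
        polyForm_legendre_of_ne hm.symm, mul_zero]
  rwa [innerSL_apply_apply, inner_smul_right, inner_polyLp_polyLp, polyForm_legendre_self,
    mul_one] at h'

theorem eq_of_legendre {Φ Ψ : ℝ[X] →ₗ[ℝ] ℝ} (h : ∀ n, Φ (legendre n) = Ψ (legendre n)) :
    Φ = Ψ := by
  have key : ∀ n : ℕ, ∀ p : ℝ[X], p.degree < n → Φ p = Ψ p := by
    intro n
    induction n with
    | zero =>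
      intro p hp
      have : p = 0 := by simpa using hp
      simp [this]
    | succ n ih =>
      intro p hp
      have hp' : p.natDegree ≤ n :=
        natDegree_le_iff_coeff_eq_zero.2 fun m hm =>
          (degree_lt_iff_coeff_zero p (n + 1)).1 hp m hm
      set s := p.coeff n / (legendre n).coeff n
      have hd : (p - s • legendre n).degree < n := by
        refine degree_lt_of_natDegree_le_of_coeff ?_ ?_
        · exact (natDegree_sub_le _ _).trans
            (max_le hp' ((natDegree_smul_le _ _).trans (natDegree_legendre_le n)))
        · rw [coeff_sub, coeff_smul, smul_eq_mul, div_mul_cancel₀ _ (coeff_legendre_ne_zero n),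
            sub_self]
      have := ih _ hd
      rw [map_sub, map_sub, map_smul, map_smul, h n] at this
      exact sub_left_injective this
  refine LinearMap.ext fun p => ?_
  exact key (p.natDegree + 1) p (degree_le_natDegree.trans_lt (by exact_mod_cast Nat.lt_succ_self _))

/-- A probability measure on `[-1, 1]` with square-summable Legendre coefficients has a density in
`L²`. -/
theorem exists_density_of_summable {ν : Measure ℝ} [IsProbabilityMeasure ν]
    (hν : ν (Set.Icc (-1 : ℝ) 1)ᶜ = 0)
    (hs : Summable fun n => (∫ x, (legendre n).eval x ∂ν) ^ 2) :
    ∃ h : ℝ → ℝ, Measurable h ∧ MemLp h 2 uniformMeasure ∧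
      ν ≤ uniformMeasure.withDensity fun x => ENNReal.ofReal (h x) := by
  obtain ⟨f, hf⟩ := exists_inner_legendre_eq hs
  have hfm : Measurable f := (Lp.stronglyMeasurable f).measurable
  have hfL : MemLp f 2 uniformMeasure := Lp.memLp f
  have hfi : Integrable f uniformMeasure := hfL.integrable (by norm_num)
  have hmom : ∀ p : ℝ[X], ∫ x, p.eval x * f x ∂uniformMeasure = ∫ x, p.eval x ∂ν := by
    let Φ : ℝ[X] →ₗ[ℝ] ℝ := ((innerSL ℝ f : Lp ℝ 2 uniformMeasure →L[ℝ] ℝ) :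
      Lp ℝ 2 uniformMeasure →ₗ[ℝ] ℝ) ∘ₗ polyLp
    let Ψ : ℝ[X] →ₗ[ℝ] ℝ :=
      { toFun := fun p => ∫ x, p.eval x ∂ν
        map_add' := fun p q => by
          simp only [eval_add]
          exact integral_add (integrable_of_compl_Icc hν p.continuous)
            (integrable_of_compl_Icc hν q.continuous)
        map_smul' := fun r p => by simp [integral_const_mul] }
    have hΦ : ∀ p, Φ p = ∫ x, p.eval x * f x ∂uniformMeasure := fun p => by
      rw [← inner_polyLp, real_inner_comm]
      rfl
    have heq : Φ = Ψ := eq_of_legendre fun n => by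
      rw [hΦ, ← inner_polyLp, hf]
      rfl
    intro p
    rw [← hΦ, heq]
    rfl
  refine ⟨f, hfm, hfL, ?_⟩
  set μ₁ := uniformMeasure.withDensity fun x => ENNReal.ofReal (f x) with hμ₁
  set μ₂ := uniformMeasure.withDensity fun x => ENNReal.ofReal (-f x) with hμ₂
  have : IsFiniteMeasure μ₁ := isFiniteMeasure_withDensity_ofReal hfi.2
  have : IsFiniteMeasure μ₂ := isFiniteMeasure_withDensity_ofReal hfi.neg.2
  have h1 : μ₁ (Set.Icc (-1 : ℝ) 1)ᶜ = 0 :=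
    withDensity_absolutelyContinuous _ _ uniformMeasure_compl_Icc
  have h2 : μ₂ (Set.Icc (-1 : ℝ) 1)ᶜ = 0 :=
    withDensity_absolutelyContinuous _ _ uniformMeasure_compl_Icc
  -- Moving the negative part of `f` to the other side compares positive measures only. Domination
  -- of `ν` by the positive part suffices, so `f ≥ 0` need not be proved.
  have hsum : ν + μ₂ = μ₁ := by
    refine ext_of_integral_eval_eq (by simp [hν, h2]) h1 fun p => ?_
    rw [integral_add_measure (integrable_of_compl_Icc hν p.continuous)
      (integrable_of_compl_Icc h2 p.continuous), ← hmom p]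
    have hi1 : Integrable (fun x => p.eval x) μ₁ := integrable_of_compl_Icc h1 p.continuous
    have hi2 : Integrable (fun x => p.eval x) μ₂ := integrable_of_compl_Icc h2 p.continuous
    rw [hμ₁, integrable_withDensity_iff_integrable_smul' (by fun_prop) (by simp)] at hi1
    rw [hμ₂, integrable_withDensity_iff_integrable_smul' (by fun_prop) (by simp)] at hi2
    rw [hμ₁, hμ₂, integral_withDensity_eq_integral_toReal_smul (by fun_prop) (by simp),
      integral_withDensity_eq_integral_toReal_smul (by fun_prop) (by simp), ← eq_sub_iff_add_eq,
      ← integral_sub hi1 hi2]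
    congr 1
    ext x
    simp only [ENNReal.toReal_ofReal', smul_eq_mul]
    rw [← sub_mul, max_zero_sub_eq_self, mul_comm]
  rw [← hsum]
  exact Measure.le_add_right le_rfl

/-! ### From the interval back to `SU(2)` -/

theorem measurable_orbitalMeasure_polarSection {s : Set SU2} (hs : MeasurableSet s) :
    Measurable fun t => orbitalMeasure (polarSection t) s := by
  have := (measurable_lintegral_orbitalMeasure (measurable_one.indicator hs)).comp
    continuous_polarSection.measurable
  simpa [Function.comp_def, lintegral_indicator_one hs] using this

theorem IsBiInvariant.measure_eq {ν : Measure SU2} [SFinite ν] (hν : IsBiInvariant ν) {s : Set SU2}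
    (hs : MeasurableSet s) :
    ν s = ∫⁻ t, orbitalMeasure (polarSection t) s ∂(ν.map height) := by
  have := hν.lintegral_eq (measurable_one.indicator hs)
  simpa [lintegral_indicator_one hs] using this

/-- Both measures mix the same orbital measures, and a Haar-null set is null for almost every one of
them. -/
theorem IsBiInvariant.absolutelyContinuous {ν : Measure SU2} [SFinite ν] (hν : IsBiInvariant ν)
    (h : ν.map height ≪ uniformMeasure) : ν ≪ haarU := by
  refine Measure.AbsolutelyContinuous.mk fun s hs h0 => ?_
  have hm := measurable_orbitalMeasure_polarSection hs
  rw [isBiInvariant_haarU.measure_eq hs, map_height_haarU, lintegral_eq_zero_iff hm] at h0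
  rw [hν.measure_eq hs, lintegral_eq_zero_iff hm]
  exact h.ae_le h0

theorem withDensity_comp_height_apply {g : ℝ → ENNReal} (hg : Measurable g) {s : Set SU2}
    (hs : MeasurableSet s) :
    haarU.withDensity (fun u => g (height u)) s =
      ∫⁻ t, orbitalMeasure (polarSection t) s ∂(uniformMeasure.withDensity g) := by
  have hgh : Measurable fun u => g (height u) := hg.comp measurable_height
  rw [withDensity_apply _ hs, ← lintegral_indicator hs,
    isBiInvariant_haarU.lintegral_eq (hgh.indicator hs), map_height_haarU,
    lintegral_withDensity_eq_lintegral_mul _ hg (measurable_orbitalMeasure_polarSection hs)]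
  refine lintegral_congr_ae ?_
  filter_upwards [compl_mem_ae_iff.2 uniformMeasure_compl_Icc] with t ht
  have ht' : height (polarSection t) = t := height_polarSection (by simpa using ht)
  rw [Pi.mul_apply, ← lintegral_indicator_one hs,
    ← lintegral_const_mul _ (measurable_one.indicator hs)]
  refine lintegral_congr_ae ?_
  filter_upwards [ae_height_eq_orbitalMeasure (polarSection t)] with x hx
  by_cases hxs : x ∈ s
  · simp [hxs, hx, ht']
  · simp [hxs]

theorem IsBiInvariant.memLp_density {ν : Measure SU2} [IsProbabilityMeasure ν]
    (hν : IsBiInvariant ν) {h : ℝ → ℝ} (hm : Measurable h) (hL : MemLp h 2 uniformMeasure)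
    (hle : ν.map height ≤ uniformMeasure.withDensity fun x => ENNReal.ofReal (h x)) :
    ν ≪ haarU ∧ MemLp (density ν) 2 haarU := by
  have hac : ν ≪ haarU := hν.absolutelyContinuous
    (hle.absolutelyContinuous.trans (withDensity_absolutelyContinuous _ _))
  refine ⟨hac, ?_⟩
  have hle' : ∀ᵐ u ∂haarU, ν.rnDeriv haarU u ≤ ENNReal.ofReal (h (height u)) := by
    refine ae_le_of_forall_setLIntegral_le_of_sigmaFinite (Measure.measurable_rnDeriv _ _)
      fun s hs _ => ?_
    rw [Measure.setLIntegral_rnDeriv hac, ← withDensity_apply _ hs,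
      withDensity_comp_height_apply (g := fun x => ENNReal.ofReal (h x)) (by fun_prop) hs,
      hν.measure_eq hs]
    exact lintegral_mono' hle le_rfl
  have hLU : MemLp (fun u => h (height u)) 2 haarU :=
    hL.comp_measurePreserving measurePreserving_height
  refine hLU.mono (Measure.measurable_rnDeriv _ _).ennreal_toReal.aestronglyMeasurable ?_
  filter_upwards [hle'] with u hu
  have h1 : density ν u ≤ max (h (height u)) 0 := by
    rw [← ENNReal.toReal_ofReal']
    exact ENNReal.toReal_mono ENNReal.ofReal_ne_top hu
  have h2 : 0 ≤ density ν u := ENNReal.toReal_nonneg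
  rw [Real.norm_of_nonneg h2]
  exact h1.trans (max_le (le_abs_self _) (abs_nonneg _))

/-! ### Three or more factors -/

theorem integral_legendre_convPow (a : SU2) (m n : ℕ) :
    ∫ x, (legendre n).eval (height x) ∂convPow (orbitalMeasure a) m =
      circleEigenvalue (height a) n ^ m * (legendre n).eval 1 := by
  induction m with
  | zero => simp [convPow, integral_dirac, height_one]
  | succ m ih =>
    rw [convPow, integral_height_mconv _ a (legendre n).continuous]
    simp_rw [← eval_circleOp (height_mem_Icc a) (height_mem_Icc _),
      circleOp_legendre (height_mem_Icc a), eval_smul, smul_eq_mul, integral_const_mul]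
    rw [ih]
    ring

theorem summable_circleEigenvalue {c : ℝ} (hc : c ^ 2 < 1) {p : ℕ} (hp : 3 ≤ p) :
    Summable fun n => (circleEigenvalue c n ^ p * (legendre n).eval 1) ^ 2 := by
  have hc' : c ∈ Set.Icc (-1 : ℝ) 1 := ⟨by nlinarith, by nlinarith⟩
  set A := (1 - c ^ 2) / 2 with hA
  have hA0 : 0 < A := by rw [hA]; linarith
  have hs : Summable fun n : ℕ => 6 / A ^ 3 * (1 / (n : ℝ) ^ 2) :=
    (Real.summable_one_div_nat_pow.2 one_lt_two).mul_left _
  refine Summable.of_norm_bounded_eventually_nat hs ?_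
  filter_upwards [Filter.eventually_ge_atTop 1] with n hn
  have hn' : (1 : ℝ) ≤ n := by exact_mod_cast hn
  have h1 := abs_circleEigenvalue_le_one hc' n
  have h2 := abs_circleEigenvalue_le hc hn
  have h3 : (circleEigenvalue c n ^ p) ^ 2 ≤ 1 / (n * A) ^ 3 := by
    calc (circleEigenvalue c n ^ p) ^ 2 = |circleEigenvalue c n| ^ (2 * p) := by
          rw [← pow_mul, mul_comm p 2, pow_mul, pow_mul |_|, sq_abs]
      _ ≤ |circleEigenvalue c n| ^ (2 * 3) :=
          pow_le_pow_of_le_one (abs_nonneg _) h1 (by omega)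
      _ ≤ (1 / √(n * A)) ^ (2 * 3) := pow_le_pow_left₀ (abs_nonneg _) h2 _
      _ = 1 / (n * A) ^ 3 := by
          rw [pow_mul, div_pow, Real.sq_sqrt (by positivity), one_pow, div_pow, one_pow]
  rw [Real.norm_of_nonneg (sq_nonneg _), mul_pow]
  calc (circleEigenvalue c n ^ p) ^ 2 * (legendre n).eval 1 ^ 2
      -- Here `4 * n + 2 ≤ 6 * n` because `n ≥ 1`.
      ≤ 1 / (n * A) ^ 3 * (6 * n) := by
        refine mul_le_mul h3 ((eval_one_sq_legendre_le n).trans ?_) (sq_nonneg _) (by positivity)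
        linarith
    _ = 6 / A ^ 3 * (1 / (n : ℝ) ^ 2) := by field_simp

theorem memLp_density_convPow {a : SU2} (ha : a ∉ Subgroup.normalizer (SO2 : Set SU2)) {p : ℕ}
    (hp : 3 ≤ p) :
    convPow (orbitalMeasure a) p ≪ haarU ∧
      MemLp (density (convPow (orbitalMeasure a) p)) 2 haarU := by
  have hc : height a ^ 2 < 1 := by
    have h := height_mem_Icc a
    refine lt_of_le_of_ne (by nlinarith [h.1, h.2]) fun h1 => ha ?_
    exact mem_normalizer_SO2_of_sq_height h1
  obtain ⟨h, hm, hL, hle⟩ := exists_density_of_summable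
    (ν := (convPow (orbitalMeasure a) p).map height) (map_height_compl_Icc _) (by
      have hint : ∀ n, ∫ x, (legendre n).eval x ∂((convPow (orbitalMeasure a) p).map height) =
          circleEigenvalue (height a) n ^ p * (legendre n).eval 1 := fun n => by
        rw [integral_map measurable_height.aemeasurable
          (legendre n).continuous.aestronglyMeasurable, integral_legendre_convPow]
      simp_rw [hint]
      exact summable_circleEigenvalue hc hp)
  exact (isBiInvariant_convPow a (by omega)).memLp_density hm hL hle

/-! ### Two factors: absolute continuity -/

/-- The preimage is covered by images of `s` under the countably many branches `2kπ ± arccos`. These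
are differentiable away from `±1`, and differentiable maps send null sets to null sets. -/
theorem volume_preimage_cos {s : Set ℝ} (hs : volume s = 0) : volume (Real.cos ⁻¹' s) = 0 := by
  have hF : ∀ φ : ℝ → ℝ, (∀ y, y ≠ -1 → y ≠ 1 → DifferentiableAt ℝ φ y) → volume (φ '' s) = 0 := by
    intro φ hφ
    have h1 : volume (φ '' (s \ {-1, 1})) = 0 := by
      refine addHaar_image_eq_zero_of_differentiableOn_of_addHaar_eq_zero volume (fun y hy => ?_)
        (measure_mono_null Set.sdiff_subset hs)
      have hy' : y ≠ -1 ∧ y ≠ 1 := by simpa [not_or] using hy.2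
      exact (hφ y hy'.1 hy'.2).differentiableWithinAt
    have h2 : volume (φ '' {-1, 1}) = 0 :=
      (((Set.finite_singleton (1 : ℝ)).insert (-1)).image φ).measure_zero _
    refine measure_mono_null ?_ (measure_union_null h1 h2)
    rw [← Set.image_union]
    exact Set.image_mono (by rw [Set.sdiff_union_self]; exact Set.subset_union_left)
  have hsub : Real.cos ⁻¹' s ⊆ (⋃ k : ℤ, (fun y => 2 * k * Real.pi + Real.arccos y) '' s) ∪
      ⋃ k : ℤ, (fun y => 2 * k * Real.pi - Real.arccos y) '' s := by
    intro t ht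
    have hc : Real.cos (Real.arccos (Real.cos t)) = Real.cos t :=
      Real.cos_arccos (Real.neg_one_le_cos t) (Real.cos_le_one t)
    obtain ⟨k, hk | hk⟩ := Real.cos_eq_cos_iff.1 hc
    · exact Or.inl (Set.mem_iUnion.2 ⟨k, Real.cos t, ht, hk.symm⟩)
    · exact Or.inr (Set.mem_iUnion.2 ⟨k, Real.cos t, ht, hk.symm⟩)
  refine measure_mono_null hsub (measure_union_null ?_ ?_) <;>
    refine measure_iUnion_null fun k => hF _ fun y h1 h2 => ?_
  · exact (Real.differentiableAt_arccos.2 ⟨h1, h2⟩).const_add _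
  · exact (Real.differentiableAt_arccos.2 ⟨h1, h2⟩).const_sub _

theorem angleMeasure_absolutelyContinuous : angleMeasure ≪ volume :=
  (Measure.smul_absolutelyContinuous).trans Measure.restrict_le_self.absolutelyContinuous

theorem volume_preimage_affine_cos {s : Set ℝ} (hs : volume s = 0) (b : ℝ) {d : ℝ} (hd : d ≠ 0) :
    volume ((fun t => b - d * Real.cos (2 * t)) ⁻¹' s) = 0 := by
  have h1 : volume ((fun x => b - x) ⁻¹' s) = 0 :=
    (Measure.measurePreserving_sub_left volume b).quasiMeasurePreserving.preimage_null hs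
  have h2 : volume ((fun x => d * x) ⁻¹' ((fun x => b - x) ⁻¹' s)) = 0 := by
    rw [Real.volume_preimage_mul_left hd, h1, mul_zero]
  have h3 := volume_preimage_cos h2
  have h4 : volume ((fun x => 2 * x) ⁻¹'
      (Real.cos ⁻¹' ((fun x => d * x) ⁻¹' ((fun x => b - x) ⁻¹' s)))) = 0 := by
    rw [Real.volume_preimage_mul_left two_ne_zero, h3, mul_zero]
  exact h4

theorem circleLaw_self_eq {c : ℝ} (hc : c ^ 2 ≤ 1) :
    circleLaw c c = angleMeasure.map fun t => c ^ 2 - (1 - c ^ 2) * Real.cos (2 * t) := by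
  unfold circleLaw
  congr 1
  ext t
  rw [Real.mul_self_sqrt (by linarith), sq]

theorem circleLaw_self_absolutelyContinuous {c : ℝ} (hc : c ^ 2 < 1) :
    circleLaw c c ≪ uniformMeasure := by
  refine Measure.AbsolutelyContinuous.mk fun s hs h0 => ?_
  rw [circleLaw_self_eq hc.le, Measure.map_apply (by fun_prop) hs]
  -- The uniform measure lives on a half-open interval, so the endpoint `-1`, attained when `c = 0`,
  -- is added by hand.
  have hvol : volume (s ∩ Set.Ioc (-1) 1 ∪ {-1}) = 0 := by
    refine measure_union_null ?_ (by simp)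
    rw [uniformMeasure, Measure.smul_apply, smul_eq_mul, Measure.restrict_apply hs] at h0
    simpa using h0
  refine measure_mono_null (fun t ht => ?_)
    (angleMeasure_absolutelyContinuous (volume_preimage_affine_cos hvol (c ^ 2)
      (by linarith : 1 - c ^ 2 ≠ 0)))
  have h1 := Real.neg_one_le_cos (2 * t)
  have h2 := Real.cos_le_one (2 * t)
  have h3 : c ^ 2 - (1 - c ^ 2) * Real.cos (2 * t) ≤ 1 := by nlinarith
  have h4 : -1 ≤ c ^ 2 - (1 - c ^ 2) * Real.cos (2 * t) := by nlinarith [sq_nonneg c]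
  rcases h4.eq_or_lt with h5 | h5
  · exact Or.inr h5.symm
  · exact Or.inl ⟨ht, h5, h3⟩

/-! ### Two factors: the density is not square integrable -/

/-- The height equals `1 - 2 * (1 - c ^ 2) * cos t ^ 2`, with a quadratic maximum `1` at `t = π /
2`; angles within `δ` of it have probability `δ / π`. -/
theorem le_circleLaw_self_Ioi {c δ : ℝ} (hc : c ^ 2 < 1) (h0 : 0 < δ) (h1 : δ ≤ 1) :
    δ / Real.pi ≤ (circleLaw c c).real (Set.Ioi (1 - 2 * δ ^ 2)) := by
  have hpi := Real.pi_gt_three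
  have hsub : Set.Ioo (Real.pi / 2 - δ) (Real.pi / 2 + δ) ⊆
      (fun t => c ^ 2 - (1 - c ^ 2) * Real.cos (2 * t)) ⁻¹' Set.Ioi (1 - 2 * δ ^ 2) := by
    intro t ht
    have hcos : Real.cos t ^ 2 < δ ^ 2 := by
      have e : Real.cos t = Real.sin (Real.pi / 2 - t) := (Real.sin_pi_div_two_sub t).symm
      rw [e]
      refine sq_lt_sq.2 (Real.abs_sin_le_abs.trans_lt ?_)
      rw [abs_of_pos h0, abs_lt]
      constructor <;> linarith [ht.1, ht.2]
    simp only [Set.mem_preimage, Set.mem_Ioi]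
    rw [Real.cos_two_mul]
    nlinarith [sq_nonneg c, sq_nonneg (Real.cos t)]
  rw [circleLaw_self_eq hc.le, Measure.real, Measure.map_apply (by fun_prop) measurableSet_Ioi]
  refine le_trans (le_of_eq ?_)
    (ENNReal.toReal_mono (measure_ne_top _ _) (measure_mono (μ := angleMeasure) hsub))
  rw [angleMeasure, Measure.smul_apply, Measure.restrict_apply measurableSet_Ioo,
    Set.inter_eq_left.2, Real.volume_Ioo, smul_eq_mul, ← ENNReal.ofReal_mul (by positivity),
    ENNReal.toReal_ofReal]
  · field_simp
    ring
  · exact mul_nonneg (by positivity) (by linarith)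
  · intro t ht
    exact ⟨by linarith [ht.1], by linarith [ht.2]⟩

theorem haarU_height_Ioi {δ : ℝ} (h0 : 0 < δ) (h1 : δ ≤ 1) :
    haarU.real (height ⁻¹' Set.Ioi (1 - 2 * δ ^ 2)) = δ ^ 2 := by
  have h2 : δ ^ 2 ≤ 1 := by nlinarith
  rw [Measure.real, ← Measure.map_apply measurable_height measurableSet_Ioi, map_height_haarU,
    uniformMeasure, Measure.smul_apply, Measure.restrict_apply measurableSet_Ioi]
  have : Set.Ioi (1 - 2 * δ ^ 2) ∩ Set.Ioc (-1) 1 = Set.Ioc (1 - 2 * δ ^ 2) 1 := by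
    ext x
    simp only [Set.mem_inter_iff, Set.mem_Ioi, Set.mem_Ioc]
    constructor
    · rintro ⟨h, -, h'⟩
      exact ⟨h, h'⟩
    · rintro ⟨h, h'⟩
      exact ⟨h, by linarith, h'⟩
  rw [this, Real.volume_Ioc, smul_eq_mul, ← ENNReal.ofReal_mul (by positivity),
    ENNReal.toReal_ofReal (by nlinarith)]
  ring

theorem not_memLp_density_convPow_two {a : SU2} (hc : height a ^ 2 < 1)
    (hac : convPow (orbitalMeasure a) 2 ≪ haarU) :
    ¬ MemLp (density (convPow (orbitalMeasure a) 2)) 2 haarU := by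
  intro hL
  set ν := convPow (orbitalMeasure a) 2 with hν
  have hpi := Real.pi_pos
  have hsq : Integrable (fun u => density ν u ^ 2) haarU := hL.integrable_sq
  have hint : Integrable (density ν) haarU := hL.integrable (by norm_num)
  set A : ℝ → Set SU2 := fun δ => height ⁻¹' Set.Ioi (1 - 2 * δ ^ 2) with hA
  have hlow : ∀ δ : ℝ, 0 < δ → δ ≤ 1 →
      1 / Real.pi ^ 2 ≤ ∫ u in A δ, density ν u ^ 2 ∂haarU := by
    intro δ h0 h1
    have e1 : ∫ u in A δ, density ν u ∂haarU = ν.real (A δ) := Measure.setIntegral_toReal_rnDeriv hac _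
    have e2 : δ / Real.pi ≤ ν.real (A δ) := by
      have := le_circleLaw_self_Ioi hc h0 h1
      rwa [← map_height_convPow_two, map_measureReal_apply measurable_height measurableSet_Ioi]
        at this
    -- Cauchy–Schwarz as a pointwise weighted inequality; the weight `π * δ` makes the constant term
    -- integrate to `δ / (2 * π)`, half of the lower bound for the mass.
    have e3 : ∫ u in A δ, density ν u ∂haarU ≤
        ∫ u in A δ, (Real.pi * δ / 2 * density ν u ^ 2 + 1 / (2 * (Real.pi * δ))) ∂haarU := by
      refine setIntegral_mono hint.integrableOn
        ((hsq.const_mul _).add (integrable_const _)).integrableOn fun u => ?_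
      have h := sq_nonneg (Real.pi * δ * density ν u - 1)
      have hk : 0 < Real.pi * δ := by positivity
      have : Real.pi * δ / 2 * density ν u ^ 2 + 1 / (2 * (Real.pi * δ)) - density ν u =
          (Real.pi * δ * density ν u - 1) ^ 2 / (2 * (Real.pi * δ)) := by
        field_simp
        ring
      have h' : 0 ≤ (Real.pi * δ * density ν u - 1) ^ 2 / (2 * (Real.pi * δ)) := by positivity
      simp only
      linarith
    rw [integral_add (hsq.const_mul _).integrableOn (integrable_const _).integrableOn,
      integral_const_mul, setIntegral_const, haarU_height_Ioi h0 h1, e1, smul_eq_mul] at e3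
    have e4 : δ ^ 2 * (1 / (2 * (Real.pi * δ))) = δ / (2 * Real.pi) := by field_simp
    rw [e4] at e3
    have e5 : δ / Real.pi - δ / (2 * Real.pi) = Real.pi * δ / 2 * (1 / Real.pi ^ 2) := by
      field_simp
      norm_num
    refine le_of_mul_le_mul_left ?_ (by positivity : 0 < Real.pi * δ / 2)
    linarith
  have hlim : Filter.Tendsto (fun n : ℕ => ∫ u in A (1 / ((n : ℝ) + 1)), density ν u ^ 2 ∂haarU)
      Filter.atTop (nhds 0) := by
    refine hsq.tendsto_setIntegral_nhds_zero ?_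
    have hm : ∀ n : ℕ, haarU (A (1 / ((n : ℝ) + 1))) = ENNReal.ofReal ((1 / ((n : ℝ) + 1)) ^ 2) := by
      intro n
      rw [← haarU_height_Ioi (δ := 1 / ((n : ℝ) + 1)) (by positivity)
        (by rw [div_le_one (by positivity)]; linarith [(n.cast_nonneg : (0 : ℝ) ≤ n)]),
        ofReal_measureReal]
    simp only [Function.comp_def, hm]
    rw [← ENNReal.ofReal_zero]
    refine ENNReal.tendsto_ofReal ?_
    simpa using (tendsto_one_div_add_atTop_nhds_zero_nat (𝕜 := ℝ)).pow 2
  have hge : 1 / Real.pi ^ 2 ≤ 0 := ge_of_tendsto' hlim fun n =>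
    hlow _ (by positivity)
      (by rw [div_le_one (by positivity)]; linarith [(n.cast_nonneg : (0 : ℝ) ≤ n)])
  have : 0 < 1 / Real.pi ^ 2 := by positivity
  linarith

theorem diagElement_convPow_two {θ : ℝ} (hθ : Real.sin (2 * θ) ≠ 0) :
    diagElement θ ∉ Subgroup.normalizer (SO2 : Set SU2) ∧
      convPow (orbitalMeasure (diagElement θ)) 2 ≪ haarU ∧
      ¬ MemLp (density (convPow (orbitalMeasure (diagElement θ)) 2)) 2 haarU := by
  have hc : height (diagElement θ) ^ 2 < 1 := by
    rw [height_diagElement, Real.cos_sq']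
    have := sq_pos_of_ne_zero hθ
    linarith
  have hac : convPow (orbitalMeasure (diagElement θ)) 2 ≪ haarU := by
    refine (isBiInvariant_convPow _ one_le_two).absolutelyContinuous ?_
    rw [map_height_convPow_two]
    exact circleLaw_self_absolutelyContinuous hc
  exact ⟨diagElement_notMem_normalizer hθ, hac, not_memLp_density_convPow_two hc hac⟩

end OrbitalSU2
open OrbitalSU2 in
theorem theorem1 :
    (∀ a : SU2, a ∉ Subgroup.normalizer (SO2 : Set SU2) → ∀ p : ℕ, 3 ≤ p →
      convPow (orbitalMeasure a) p ≪ haarU ∧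
        MemLp (density (convPow (orbitalMeasure a) p)) 2 haarU) ∧
    (∀ θ : ℝ, θ ∈ Set.Ioo (Real.pi / 12) (5 * Real.pi / 12) →
      diagElement θ ∉ Subgroup.normalizer (SO2 : Set SU2) ∧
        convPow (orbitalMeasure (diagElement θ)) 2 ≪ haarU ∧
        ¬ MemLp (density (convPow (orbitalMeasure (diagElement θ)) 2)) 2 haarU) ∧
    ¬ (∀ a : SU2, a ∉ Subgroup.normalizer (SO2 : Set SU2) → ∀ p : ℕ, 1 ≤ p →
      (convPow (orbitalMeasure a) p ≪ haarU ↔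
        convPow (orbitalMeasure a) p ≪ haarU ∧
          MemLp (density (convPow (orbitalMeasure a) p)) 2 haarU)) := by
  have hpi := Real.pi_pos
  have h2 : ∀ θ : ℝ, θ ∈ Set.Ioo (Real.pi / 12) (5 * Real.pi / 12) →
      diagElement θ ∉ Subgroup.normalizer (SO2 : Set SU2) ∧
        convPow (orbitalMeasure (diagElement θ)) 2 ≪ haarU ∧
        ¬ MemLp (density (convPow (orbitalMeasure (diagElement θ)) 2)) 2 haarU := fun θ hθ =>
    -- On the given interval `2 * θ` lies in `(π/6, 5π/6)`, where the sine is positive.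
    diagElement_convPow_two
      (Real.sin_pos_of_pos_of_lt_pi (by linarith [hθ.1]) (by linarith [hθ.2])).ne'
  refine ⟨fun a ha p hp => memLp_density_convPow ha hp, h2, fun h => ?_⟩
  obtain ⟨hn, hac, hL⟩ := h2 (Real.pi / 4) ⟨by linarith, by linarith⟩
  exact hL ((h _ hn 2 one_le_two).1 hac).2
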